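/- Let $A$ be a plane curve singularity of type $D_n$ with $n\ge 4$, that is, a $\mathbb C$-algebra isomorphic to $\mathbb C[[X,Y]]/\langle X(Y^2-X^{n-2})\rangle$. Let $Q(A)$ be its total ring of fractions. For a ring $A\subseteq B\subseteq Q(A)$ and an ideal $J$ of $B$ containing a non-zerodivisor of $A$, identify $\operatorname{End}_B(J)$ with $\{q\in Q(A)\mid qJ\subseteq J\}$. Let $\mathfrak m_B$ denote the Jacobson radical of $B$ (its maximal ideal if $B$ is local), and set $B'=\operatorname{End}_B(\mathfrak m_B)$. Let $n(A)$ be the number of steps of the normalization algorithm, i.e. the least $m$ with $A_m=A_{m+1}$, where $A_0=A$ and $A_{i+1}=\operatorname{End}_{A_i}(\sqrt{\mathfrak m_A A_i})$. Say that a $\mathbb C$-algebra is of type $A_k$ ($k\ge 1$) if it is isomorphic to $\mathbb C[[X,Y]]/\langle X^2-Y^{k+1}\rangle$, and of type $A_k\vee L$ (an entry of Frühbis-Krüger's list of simple space curve singularities) if it is isomorphic to the quotient of $\mathbb C[[X,Y,Z]]$ by the maximal minors of $$\begin{pmatrix} Z & Y & X^{k}\\ 0 & X & Y\end{pmatrix}.$$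 Then: 1. $A'$ is of type $A_{n-3}\vee L$. It is a transversal union of an $A_{n-3}$-singularity and a line: there are ideals $I,J$ of $\mathbb C[[X,Y,Z]]$ such that $A'\cong\mathbb C[[X,Y,Z]]/(I\cap J)$, $\mathbb C[[X,Y,Z]]/I$ is of type $A_{n-3}$, $\mathbb C[[X,Y,Z]]/J\cong\mathbb C[[t]]$, and $I+J=\langle X,Y,Z\rangle$. Moreover, $A'$ is a Noetherian local ring that is not Gorenstein. 2. If $n\ge 6$, then $A''=(A')'$ is the disjoint union of an $A_{n-5}$-singularity and a line, i.e. $A''\cong \mathbb C[[X,Y]]/\langle X^2-Y^{n-4}\rangle\times\mathbb C[[t]]$. If $n=4$ or $n=5$, then $A''$ is smooth, i.e. a regular ring. 3. $n(A)=\lfloor n/2\rfloor$. -/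

import Mathlib

universe u

/-! ### Endomorphism rings of ideals and the normalization steps

`FractionRing A` is the localization of `A` at its non-zerodivisors, that is, the total ring of
fractions `Q(A)`; `A` need not be a domain. Intermediate rings `A ⊆ B ⊆ Q(A)` are
`A`-subalgebras of `Q(A)`; the ring `A` itself is `⊥`. -/

/-- For a ring `A ⊆ B ⊆ Q(A)` and an ideal `J` of `B`, the endomorphism ring `End_B(J)`, regarded
as the ring `{q ∈ Q(A) | q J ⊆ J}`. If `J` contains a unit of `Q(A)`, then every endomorphism of
the `B`-module `J` is multiplication by a unique element of this ring,
see `existsUnique_mem_endRing`. -/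
def endRing {A : Type u} [CommRing A] (B : Subalgebra A (FractionRing A)) (J : Ideal B) :
    Subalgebra A (FractionRing A) where
  carrier := {q | ∀ x ∈ J, ∃ y ∈ J, (y : FractionRing A) = q * (x : FractionRing A)}
  mul_mem' := by
    intro p q hp hq x hx
    obtain ⟨y, hy, hyx⟩ := hq x hx
    obtain ⟨z, hz, hzy⟩ := hp y hy
    exact ⟨z, hz, by rw [hzy, hyx, mul_assoc]⟩
  add_mem' := by
    intro p q hp hq x hx
    obtain ⟨y, hy, hyx⟩ := hp x hx
    obtain ⟨z, hz, hzx⟩ := hq x hx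
    exact ⟨y + z, J.add_mem hy hz, by rw [add_mul, ← hyx, ← hzx]; rfl⟩
  algebraMap_mem' := by
    intro a x hx
    exact ⟨algebraMap A B a * x, J.mul_mem_left _ hx, rfl⟩

theorem mem_endRing {A : Type u} [CommRing A] {B : Subalgebra A (FractionRing A)} {J : Ideal B}
    {q : FractionRing A} : q ∈ endRing B J ↔
      ∀ x ∈ J, ∃ y ∈ J, (y : FractionRing A) = q * (x : FractionRing A) :=
  Iff.rfl

theorem mul_apply_comm {B : Type u} [CommRing B] {J : Ideal B} (φ : Module.End B J) (g x : J) :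
    (g : B) * (φ x : B) = (x : B) * (φ g : B) := by
  have h : (g : B) • φ x = (x : B) • φ g := by
    rw [← map_smul, ← map_smul]
    congr 1
    ext1
    exact mul_comm _ _
  exact congrArg (fun z : J => (z : B)) h

/-- The identification of `End_B(J)` with a subring of `Q(A)`. -/
theorem existsUnique_mem_endRing {A : Type u} [CommRing A] {B : Subalgebra A (FractionRing A)}
    {J : Ideal B} (g : J) (hg : IsUnit ((g : B) : FractionRing A)) (φ : Module.End B J) :
    ∃! q : FractionRing A, q ∈ endRing B J ∧
      ∀ x : J, ((φ x : B) : FractionRing A) = q * ((x : B) : FractionRing A) := by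
  obtain ⟨v, hv⟩ := hg
  have key : ∀ x : J, ((φ x : B) : FractionRing A)
      = (((φ g : B) : FractionRing A) * (↑v⁻¹ : FractionRing A))
        * ((x : B) : FractionRing A) := by
    intro x
    have h1 := mul_apply_comm φ g x
    have h2 : ((g : B) : FractionRing A) * ((φ x : B) : FractionRing A)
        = ((x : B) : FractionRing A) * ((φ g : B) : FractionRing A) :=
      congrArg (fun z : B => (z : FractionRing A)) h1
    rw [← hv] at h2
    have h3 : (v : FractionRing A) * (↑v⁻¹ : FractionRing A) = 1 := v.mul_inv
    linear_combination (↑v⁻¹ : FractionRing A) * h2 - ((φ x : B) : FractionRing A) * h3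
  refine ⟨_, ⟨fun x hx => ⟨(φ ⟨x, hx⟩ : B), (φ ⟨x, hx⟩).2, key ⟨x, hx⟩⟩, key⟩, ?_⟩
  rintro q ⟨-, hq⟩
  have h4 := hq g
  rw [← hv] at h4
  rw [h4, mul_assoc, v.mul_inv, mul_one]

/-- `B' = End_B(m_B)`, where `m_B` is the Jacobson radical of `B` (the maximal ideal, if `B` is
local). -/
def primeRing {A : Type u} [CommRing A] (B : Subalgebra A (FractionRing A)) :
    Subalgebra A (FractionRing A) :=
  endRing B (Ring.jacobson B)

/-- The chain of rings `A_0 = A`, `A_{i+1} = End_{A_i}(J_i)`, where `J_i` is the radical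
of `J A_i`. -/
def normStep {A : Type u} [CommRing A] (J : Ideal A) : ℕ → Subalgebra A (FractionRing A)
  | 0 => ⊥
  | i + 1 => endRing (normStep J i) ((J.map (algebraMap A (normStep J i))).radical)

/-- `n(A, J)`: the least `n` with `A_n = A_{n+1}`. -/
noncomputable def numSteps {A : Type u} [CommRing A] (J : Ideal A) : ℕ :=
  sInf {n | normStep J n = normStep J (n + 1)}

/-- `n(A) = n(A, m_A)` for a (non-normal) local ring `A`. -/
noncomputable def numNormSteps (A : Type u) [CommRing A] : ℕ :=
  numSteps (Ring.jacobson A)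

/-! ### Singularity types -/

/-- `ℂ[[X, Y]] / ⟨X² - Y^(k+1)⟩`. -/
abbrev SingA (k : ℕ) : Type :=
  MvPowerSeries (Fin 2) ℂ ⧸
    Ideal.span {(MvPowerSeries.X 0 ^ 2 - MvPowerSeries.X 1 ^ (k + 1) : MvPowerSeries (Fin 2) ℂ)}

/-- `ℂ[[X, Y]] / ⟨X (Y² - X^(n-2))⟩`, for `n ≥ 4`. -/
abbrev SingD (n : ℕ) : Type :=
  MvPowerSeries (Fin 2) ℂ ⧸
    Ideal.span {(MvPowerSeries.X 0 * (MvPowerSeries.X 1 ^ 2 - MvPowerSeries.X 0 ^ (n - 2)) :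
      MvPowerSeries (Fin 2) ℂ)}

/-- The ideal of maximal minors of a `2 × 3` matrix. -/
def maximalMinors {R : Type u} [CommRing R] (M : Matrix (Fin 2) (Fin 3) R) : Ideal R :=
  Ideal.span (Set.range fun f : Fin 2 → Fin 3 => (M.submatrix id f).det)

/-- The matrix with rows `(Z, Y, X^k)` and `(0, X, Y)`. -/
noncomputable def matrixAVeeL (k : ℕ) : Matrix (Fin 2) (Fin 3) (MvPowerSeries (Fin 3) ℂ) :=
  !![MvPowerSeries.X 2, MvPowerSeries.X 1, MvPowerSeries.X 0 ^ k;
     0, MvPowerSeries.X 0, MvPowerSeries.X 1]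

/-- The space curve singularity `A_k ∨ L`, given by its presentation matrix. -/
abbrev SingAVeeL (k : ℕ) : Type :=
  MvPowerSeries (Fin 3) ℂ ⧸ maximalMinors (matrixAVeeL k)

/-- `B` is a plane curve singularity of type `A_k`. -/
def IsTypeA (k : ℕ) (B : Type u) [CommRing B] [Algebra ℂ B] : Prop :=
  Nonempty (B ≃ₐ[ℂ] SingA k)

/-- `B` is a plane curve singularity of type `D_n`. -/
def IsTypeD (n : ℕ) (B : Type u) [CommRing B] [Algebra ℂ B] : Prop :=
  Nonempty (B ≃ₐ[ℂ] SingD n)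

/-- `B` is a space curve singularity of type `A_k ∨ L`. -/
def IsTypeAVeeL (k : ℕ) (B : Type u) [CommRing B] [Algebra ℂ B] : Prop :=
  Nonempty (B ≃ₐ[ℂ] SingAVeeL k)

/-- `B` is the local ring of the union, in 3-space, of a curve `V(I)` of type `A_k` and a smooth
branch `V(J)` that meets it transversally: `I + J` is the maximal ideal, which for `k ≥ 1` means
that the tangent line of `V(J)` does not lie in the Zariski tangent plane of `V(I)`. -/
def IsTransversalUnionALine (k : ℕ) (B : Type u) [CommRing B] [Algebra ℂ B] : Prop :=
  ∃ I J : Ideal (MvPowerSeries (Fin 3) ℂ),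
    Nonempty (B ≃ₐ[ℂ] MvPowerSeries (Fin 3) ℂ ⧸ (I ⊓ J)) ∧
    IsTypeA k (MvPowerSeries (Fin 3) ℂ ⧸ I) ∧
    Nonempty ((MvPowerSeries (Fin 3) ℂ ⧸ J) ≃ₐ[ℂ] PowerSeries ℂ) ∧
    I ⊔ J = IsLocalRing.maximalIdeal (MvPowerSeries (Fin 3) ℂ)

/-- `R` is a Gorenstein local ring: a Noetherian local ring of finite injective dimension
over itself. -/
def IsGorensteinLocalRing (R : Type u) [CommRing R] : Prop :=
  IsLocalRing R ∧ IsNoetherianRing R ∧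
    ∃ d : ℕ, CategoryTheory.HasInjectiveDimensionLE (ModuleCat.of R R) d

/-! Write n = 2(l+1) + m + 2 with m ∈ {0, 1}. The normalization of A is T = ℂ[[X]][u]/(u² - X^m) ×
ℂ[[X]] (`DoubleCoverLine m`). The curve Y² = X^(n-2) is parametrized by Y = X^(l+1) u, and the
second factor is the line X = 0 with coordinate Y. Thus A consists of the pairs (a + bu, g) with
X^(l+1) ∣ b, a(0) = g(0), and the coefficient of X^(l+1) in b equal to the linear coefficient of g
(`tangentRing`).

Every ring S of the algorithm is a subring of T cut out by conditions of this kind and containing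
the (X, X)^(l+2)-multiples of T. Because of this conductor, the radical ideals that occur are S ∩ N,
where N is the Jacobson radical of T. Moreover S ∩ N contains a non-zerodivisor of T that divides,
in T, all of S ∩ N, so the endomorphism ring lies in T and can be computed there (`endRing_map_eq`,
`mem_ringChain_succ_iff`). The first step drops the condition on linear terms and gives A'
(`gluedRing`). The second drops the gluing condition and one power of X, and gives A''
(`disjointRing`). Each later step drops one more power of X, until T is reached after l + 2 = ⌊n/2⌋
steps.

The subrings are matched with the given equations by Weierstrass division, which makes ℂ[[X, Y]]/(Y²
- X^m) free over ℂ[[X]] on 1, Y.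

A' is not Gorenstein: the ideal (Z) is a direct summand of its own second syzygy, so finite
injective dimension would force Ext¹((Z), A') = 0. Every homomorphism (X, Y) → A' would then be
multiplication by an element of A', but multiplication by Y/X is not
(`not_hasInjectiveDimensionLE`). -/

/-! ### Subrings of an overring with a conductor -/

/-- A ring `T` with `A ⊆ T` embeds into the total ring of fractions of `A` if `c T ⊆ A` for some
element `c` of `A` that is a non-zerodivisor of `T`. -/
theorem exists_algHom_fractionRing {A : Type u} {T : Type*} [CommRing A] [CommRing T] [Algebra A T]
    (hinj : Function.Injective (algebraMap A T)) (c : A)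
    (hc : algebraMap A T c ∈ nonZeroDivisors T)
    (hcT : ∀ t, ∃ a, algebraMap A T a = algebraMap A T c * t) :
    ∃ ι : T →ₐ[A] FractionRing A, Function.Injective ι ∧
      ∀ v ∈ nonZeroDivisors T, IsUnit (ι v) := by
  have hreg : ∀ a ∈ nonZeroDivisors A, algebraMap A T a ∈ nonZeroDivisors T := by
    intro a ha
    rw [mem_nonZeroDivisors_iff_right] at ha hc ⊢
    intro t ht
    obtain ⟨b, hb⟩ := hcT t
    have h1 : b * a = 0 := hinj (by rw [map_mul, hb, mul_assoc, ht, mul_zero, map_zero])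
    rw [ha b h1, map_zero] at hb
    exact hc t (by rw [mul_comm, ← hb])
  -- A fraction t/s over T equals (ct)/(cs), whose numerator and denominator lie in A; so A and T
  -- have the same total ring of fractions.
  have hloc : IsFractionRing A (FractionRing T) := by
    refine ⟨?_, ?_, ?_⟩
    · rintro ⟨a, ha⟩
      rw [IsScalarTower.algebraMap_apply A T]
      exact IsLocalization.map_units (FractionRing T) (⟨_, hreg a ha⟩ : nonZeroDivisors T)
    · intro z
      obtain ⟨⟨t, s⟩, hz⟩ := IsLocalization.surj (nonZeroDivisors T) z
      obtain ⟨a, ha⟩ := hcT t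
      obtain ⟨b, hb⟩ := hcT s
      have hb' : b ∈ nonZeroDivisors A := by
        rw [mem_nonZeroDivisors_iff_right]
        intro x hx
        apply hinj
        have : algebraMap A T b ∈ nonZeroDivisors T := hb ▸ mul_mem hc s.2
        rw [map_zero]
        refine (mem_nonZeroDivisors_iff_right.1 this) _ ?_
        rw [← map_mul, hx, map_zero]
      refine ⟨⟨a, ⟨b, hb'⟩⟩, ?_⟩
      dsimp only at hz ⊢
      rw [IsScalarTower.algebraMap_apply A T _ b, IsScalarTower.algebraMap_apply A T _ a, ha, hb,
        map_mul, map_mul, ← hz]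
      ring
    · intro a b hab
      rw [IsScalarTower.algebraMap_apply A T, IsScalarTower.algebraMap_apply A T _ b] at hab
      exact ⟨1, by rw [hinj (IsFractionRing.injective T (FractionRing T) hab)]⟩
  let e : FractionRing T ≃ₐ[A] FractionRing A :=
    IsLocalization.algEquiv (nonZeroDivisors A) (FractionRing T) (FractionRing A)
  refine ⟨(e : FractionRing T →ₐ[A] FractionRing A).comp (IsScalarTower.toAlgHom A T _), ?_, ?_⟩
  · exact e.injective.comp (IsFractionRing.injective T (FractionRing T))
  · intro v hv
    exact (IsLocalization.map_units (FractionRing T) (⟨v, hv⟩ : nonZeroDivisors T)).map e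

section Conductor

variable {A : Type u} {T : Type*} [CommRing A] [CommRing T] [Algebra A T]
  {ι : T →ₐ[A] FractionRing A}

/-- If q stabilizes J, then qv lies in J and hence in vT; as v is invertible in Q(A), this puts q in
T. The remaining condition on q is the one that defines S'. -/
theorem endRing_map_eq {S S' : Subalgebra A T} {J : Ideal (S.map ι)} {N : Ideal T}
    (hJ : ∀ x : S.map ι, x ∈ J ↔ ∃ i ∈ S, i ∈ N ∧ ι i = x) {v : T} (hvS : v ∈ S) (hvN : v ∈ N)
    (hv : IsUnit (ι v)) (hι : Function.Injective ι) (hdvd : ∀ i ∈ S, i ∈ N → v ∣ i)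
    (hS' : ∀ t, t ∈ S' ↔ ∀ i ∈ S, i ∈ N → t * i ∈ S ∧ t * i ∈ N) :
    endRing (S.map ι) J = S'.map ι := by
  ext q
  rw [mem_endRing, Subalgebra.mem_map]
  constructor
  · intro hq
    obtain ⟨y, hy, hyq⟩ := hq ⟨ι v, v, hvS, rfl⟩ ((hJ _).2 ⟨v, hvS, hvN, rfl⟩)
    obtain ⟨i, hiS, hiN, hi⟩ := (hJ y).1 hy
    obtain ⟨t, rfl⟩ := hdvd i hiS hiN
    have hqt : q = ι t := by
      refine hv.mul_right_cancel ?_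
      rw [← hyq, ← hi, map_mul, mul_comm]
    subst hqt
    refine ⟨t, (hS' t).2 fun i hiS hiN => ?_, rfl⟩
    obtain ⟨y, hy, hyq⟩ := hq ⟨ι i, i, hiS, rfl⟩ ((hJ _).2 ⟨i, hiS, hiN, rfl⟩)
    obtain ⟨i', hiS', hiN', hi'⟩ := (hJ y).1 hy
    have : i' = t * i := hι (by rw [hi', hyq, map_mul])
    exact this ▸ ⟨hiS', hiN'⟩
  · rintro ⟨t, ht, rfl⟩ x hx
    obtain ⟨i, hiS, hiN, hi⟩ := (hJ x).1 hx
    obtain ⟨h1, h2⟩ := (hS' t).1 ht i hiS hiN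
    exact ⟨⟨ι (t * i), t * i, h1, rfl⟩, (hJ _).2 ⟨_, h1, h2, rfl⟩, by
      rw [← hi]; exact map_mul ι t i⟩

/-- The hypothesis `hloc` says that elements of R outside N are units modulo N. Conversely, if f x ∈
N then 1 + xy is invertible in T, and `hpow` brings the inverse back to R. -/
theorem mem_jacobson_iff_map_mem {R : Type*} [CommRing R] {f : R →+* T}
    (hf : Function.Injective f) {N : Ideal T} (hN : N ≠ ⊤) (hunit : ∀ t ∈ N, IsUnit (1 + t))
    (hpow : ∀ t ∈ N, ∃ k : ℕ, ∀ t', ∃ r, f r = t ^ k * t')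
    (hloc : ∀ r, f r ∈ N ∨ ∃ y, f (r * y + 1) ∈ N) (x : R) :
    x ∈ Ring.jacobson R ↔ f x ∈ N := by
  rw [← Ideal.jacobson_bot, Ideal.mem_jacobson_bot]
  constructor
  · intro h
    refine (hloc x).resolve_right ?_
    rintro ⟨y, hy⟩
    exact hN (Ideal.eq_top_of_isUnit_mem _ hy ((h y).map f))
  · intro hx y
    have hxy : -(f (x * y)) ∈ N := by
      rw [neg_mem_iff, map_mul]
      exact N.mul_mem_right _ hx
    have hxy' : f (x * y) ∈ N := by simpa using hxy
    obtain ⟨k, hk⟩ := hpow _ hxy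
    obtain ⟨u, hu⟩ := hunit _ hxy'
    obtain ⟨r, hr⟩ := hk ↑u⁻¹
    -- the inverse is a truncated geometric series plus a remainder in the conductor
    refine IsUnit.of_mul_eq_one ((∑ i ∈ Finset.range k, (-(x * y)) ^ i) + r) (hf ?_)
    have hg := mul_neg_geom_sum (-(f (x * y))) k
    have hu' : (1 + f (x * y)) * (↑u⁻¹ : T) = 1 := by rw [← hu, u.mul_inv]
    rw [map_mul, map_add, map_add, map_one, hr, map_sum]
    simp only [map_pow, map_neg]
    linear_combination hg + (-(f (x * y))) ^ k * hu'

/-- One inclusion holds because N is radical. For the other, t ∈ N has t^k T ⊆ A for some k, so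
t^(k+1) already lies in A ∩ N, the Jacobson radical of A. -/
theorem mem_radical_map_jacobson_iff {N : Ideal T} (hrad : N.IsRadical)
    (hjac : ∀ a : A, a ∈ Ring.jacobson A ↔ algebraMap A T a ∈ N)
    (hpow : ∀ t ∈ N, ∃ k : ℕ, ∀ t', ∃ a, algebraMap A T a = t ^ k * t')
    (hι : Function.Injective ι) (S : Subalgebra A T) (x : S.map ι) :
    x ∈ ((Ring.jacobson A).map (algebraMap A (S.map ι))).radical ↔ ∃ i ∈ S, i ∈ N ∧ ι i = x := by
  let e : S ≃ₐ[A] S.map ι := S.equivMapOfInjective ι hι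
  have he : ∀ s : S, ((e s : S.map ι) : FractionRing A) = ι s := fun s => rfl
  constructor
  · rintro ⟨k, hk⟩
    have hle : (Ring.jacobson A).map (algebraMap A (S.map ι)) ≤
        N.comap (S.val.comp (e.symm : S.map ι →ₐ[A] S)) := by
      rw [Ideal.map_le_iff_le_comap]
      intro a ha
      rw [Ideal.mem_comap, Ideal.mem_comap, AlgHom.commutes]
      exact (hjac a).1 ha
    have h1 := hle hk
    rw [Ideal.mem_comap, map_pow] at h1
    refine ⟨(e.symm x : T), (e.symm x).2, hrad ⟨k, h1⟩, ?_⟩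
    rw [← he, e.apply_symm_apply]
  · rintro ⟨i, hiS, hiN, hi⟩
    obtain ⟨k, hk⟩ := hpow i hiN
    obtain ⟨a, ha⟩ := hk i
    refine ⟨k + 1, ?_⟩
    have hx : x ^ (k + 1) = algebraMap A (S.map ι) a := by
      apply Subtype.ext
      rw [SubmonoidClass.coe_pow, ← hi, ← map_pow, pow_succ, ← ha, AlgHom.commutes]
      rfl
    rw [hx]
    refine Ideal.mem_map_of_mem _ ((hjac a).2 ?_)
    rw [ha]
    exact N.mul_mem_left _ hiN

theorem mem_jacobson_map_iff {N : Ideal T} (hN : N ≠ ⊤) (hunit : ∀ t ∈ N, IsUnit (1 + t))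
    (hpow : ∀ t ∈ N, ∃ k : ℕ, ∀ t', ∃ a, algebraMap A T a = t ^ k * t')
    (hι : Function.Injective ι) {S : Subalgebra A T}
    (hloc : ∀ s ∈ S, s ∈ N ∨ ∃ y ∈ S, s * y + 1 ∈ N) (x : S.map ι) :
    x ∈ Ring.jacobson (S.map ι) ↔ ∃ i ∈ S, i ∈ N ∧ ι i = x := by
  let e : S ≃ₐ[A] S.map ι := S.equivMapOfInjective ι hι
  have he : ∀ s : S, ((e s : S.map ι) : FractionRing A) = ι s := fun s => rfl
  let f : S.map ι →ₐ[A] T := S.val.comp (e.symm : S.map ι →ₐ[A] S)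
  have hf : ∀ s : S, f (e s) = s := fun s => congrArg Subtype.val (e.symm_apply_apply s)
  rw [mem_jacobson_iff_map_mem (f := (f : S.map ι →+* T))
    (Subtype.val_injective.comp e.symm.injective) hN hunit]
  · constructor
    · intro h
      exact ⟨(e.symm x : T), (e.symm x).2, h, by rw [← he, e.apply_symm_apply]⟩
    · rintro ⟨i, hiS, hiN, hi⟩
      have : x = e ⟨i, hiS⟩ := Subtype.ext hi.symm
      rw [this]
      exact (hf ⟨i, hiS⟩).symm ▸ hiN
  · intro t ht
    obtain ⟨k, hk⟩ := hpow t ht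
    refine ⟨k, fun t' => ?_⟩
    obtain ⟨a, ha⟩ := hk t'
    exact ⟨algebraMap A _ a, by rw [← ha]; exact f.commutes a⟩
  · intro r
    obtain ⟨⟨s, hs⟩, rfl⟩ := e.surjective r
    rcases hloc s hs with h | ⟨y, hy, h⟩
    · left
      exact (hf ⟨s, hs⟩).symm ▸ h
    · right
      refine ⟨e ⟨y, hy⟩, ?_⟩
      have : f (e ⟨s, hs⟩ * e ⟨y, hy⟩ + 1) = s * y + 1 := by
        rw [map_add, map_mul, hf, hf, map_one]
      exact this.symm ▸ h

end Conductor

/-! ### Ext groups and infinite injective dimension. -/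

-- Dimension shift in the long exact sequence of 0 → ker f → P → N → 0, where P is projective.
open CategoryTheory Abelian in
theorem subsingleton_ext_ker {R : Type u} [CommRing R] {P N : Type u} [AddCommGroup P] [Module R P]
    [AddCommGroup N] [Module R N] [Module.Projective R P] {f : P →ₗ[R] N}
    (hf : Function.Surjective f) {Y : ModuleCat.{u} R} {i : ℕ}
    (h : Subsingleton (Ext (ModuleCat.of R N) Y (i + 2))) :
    Subsingleton (Ext (ModuleCat.of R (LinearMap.ker f)) Y (i + 1)) := by
  have hS := LinearMap.shortExact_shortComplexKer hf
  have : Projective (ModuleCat.of R P) := (ModuleCat.of R P).projective_of_categoryTheory_projective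
  refine subsingleton_of_forall_eq 0 fun x => ?_
  obtain ⟨x₂, hx₂⟩ := Ext.contravariant_sequence_exact₁ hS Y x (n₁ := i + 2) (by omega)
    (h.elim _ _)
  have h0 : x₂ = 0 := @Ext.eq_zero_of_projective _ _ _ _ (ModuleCat.of R P) Y i this x₂
  rw [← hx₂, h0, Ext.comp_zero]

open CategoryTheory Abelian in
theorem subsingleton_ext_of_retract {C : Type*} [Category C] [Abelian C] [HasExt C] {X X' Y : C}
    (s : X ⟶ X') (r : X' ⟶ X) (hsr : s ≫ r = 𝟙 X) {i : ℕ} (h : Subsingleton (Ext X' Y i)) :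
    Subsingleton (Ext X Y i) := by
  refine subsingleton_of_forall_eq 0 fun x => ?_
  rw [← Ext.mk₀_id_comp x, ← hsr, ← Ext.mk₀_comp_mk₀_assoc,
    h.elim ((Ext.mk₀ r).comp x (zero_add i)) 0, Ext.comp_zero]

open CategoryTheory Abelian in
theorem exists_extension_of_subsingleton_ext_one {R : Type u} [CommRing R] {P N Y : Type u}
    [AddCommGroup P] [Module R P] [AddCommGroup N] [Module R N] [AddCommGroup Y] [Module R Y]
    {f : P →ₗ[R] N} (hf : Function.Surjective f)
    (h : Subsingleton (Ext (ModuleCat.of R N) (ModuleCat.of R Y) 1))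
    (φ : LinearMap.ker f →ₗ[R] Y) : ∃ ψ : P →ₗ[R] Y, ∀ x : LinearMap.ker f, ψ x = φ x := by
  have hS := LinearMap.shortExact_shortComplexKer hf
  obtain ⟨x₂, hx₂⟩ := Ext.contravariant_sequence_exact₁ hS (ModuleCat.of R Y)
    (Ext.mk₀ (ModuleCat.ofHom φ)) (n₁ := 1) rfl (h.elim _ _)
  obtain ⟨ψ, rfl⟩ := (Ext.mk₀_bijective _ _).2 x₂
  rw [Ext.mk₀_comp_mk₀] at hx₂
  have h1 := (Ext.mk₀_bijective _ _).1 hx₂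
  exact ⟨ψ.hom, fun x => congrArg (fun g => g.hom x) h1⟩

/-- A ring with elements `x`, `y`, `z` such that `ann z = (x, y)`, `(z) ∩ (x, y) = 0`, the
coefficients of `x` in relations between `x` and `y` are contained in `(x, y, z)`, and `y / x` is a
well-defined homomorphism on `(x, y)` that is not induced by an element of the ring, has infinite
injective dimension. -/
theorem not_hasInjectiveDimensionLE {R : Type u} [CommRing R] {x y z y' : R}
    (hann : ∀ r, r * z = 0 ↔ ∃ a b, r = a * x + b * y) (hz : ∀ r, r * z * z = 0 → r * z = 0)
    (hsyz : ∀ a b, a * x + b * y = 0 → ∃ c, (a - c * z) * z = 0)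
    (hmap : ∀ a b, a * x + b * y = 0 → a * y + b * y' = 0) (hy : ∀ r, y ≠ r * x) (d : ℕ) :
    ¬ CategoryTheory.HasInjectiveDimensionLE (ModuleCat.of R R) d := by
  intro hd
  let Y := ModuleCat.of R R
  let L := LinearMap.range (LinearMap.toSpanSingleton R R z)
  let f₁ : R →ₗ[R] L := (LinearMap.toSpanSingleton R R z).rangeRestrict
  have hf₁ : Function.Surjective f₁ := LinearMap.surjective_rangeRestrict _
  have hf₁z : ∀ r, ((f₁ r : L) : R) = r * z := fun r => rfl
  have hker : ∀ r, r ∈ LinearMap.ker f₁ ↔ r * z = 0 := by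
    intro r
    rw [LinearMap.mem_ker, ← Subtype.coe_inj, hf₁z]
    rfl
  let g : R × R →ₗ[R] R :=
    (LinearMap.toSpanSingleton R R x).coprod (LinearMap.toSpanSingleton R R y)
  let f₂ : R × R →ₗ[R] LinearMap.ker f₁ :=
    g.codRestrict _ fun p => (hker _).2 ((hann _).2 ⟨p.1, p.2, rfl⟩)
  have hf₂ : Function.Surjective f₂ := by
    rintro ⟨r, hr⟩
    obtain ⟨a, b, rfl⟩ := (hann r).1 ((hker r).1 hr)
    exact ⟨(a, b), rfl⟩
  have hker₂ : ∀ p : R × R, p ∈ LinearMap.ker f₂ ↔ p.1 * x + p.2 * y = 0 := by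
    intro p
    rw [LinearMap.mem_ker, ← Subtype.coe_inj]
    rfl
  have hxz : x * z = 0 := (hann x).2 ⟨1, 0, by ring⟩
  -- `L` is a direct summand of the module of relations
  have hretract : ∃ (s : L →ₗ[R] LinearMap.ker f₂) (ρ : LinearMap.ker f₂ →ₗ[R] L),
      ρ ∘ₗ s = LinearMap.id := by
    let s : L →ₗ[R] LinearMap.ker f₂ :=
      ((LinearMap.inl R R R).comp L.subtype).codRestrict _ (by
        rintro ⟨_, r, rfl⟩
        rw [hker₂]
        change r * z * x + 0 * y = 0
        linear_combination r * hxz)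
    let j : L →ₗ[R] R ⧸ LinearMap.ker f₁ := (LinearMap.ker f₁).mkQ.comp L.subtype
    have hj : Function.Injective j := by
      rw [← LinearMap.ker_eq_bot, LinearMap.ker_eq_bot']
      rintro ⟨_, r, rfl⟩ hr
      have : r * z ∈ LinearMap.ker f₁ := (Submodule.Quotient.mk_eq_zero _).1 hr
      exact Subtype.ext (hz r ((hker _).1 this))
    -- A relation (a, b) is sent to the class of a modulo ann z. By `hsyz` this class comes from L =
    -- (z), which embeds into R / ann z by `hz`.
    let ρ : LinearMap.ker f₂ →ₗ[R] L := (LinearEquiv.ofInjective j hj).symm.toLinearMap.comp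
      (((LinearMap.ker f₁).mkQ.comp ((LinearMap.fst R R R).comp
        (LinearMap.ker f₂).subtype)).codRestrict _ (by
          rintro ⟨⟨a, b⟩, hab⟩
          obtain ⟨c, hc⟩ := hsyz a b ((hker₂ _).1 hab)
          refine ⟨⟨c * z, c, rfl⟩, ?_⟩
          refine ((Submodule.Quotient.eq _).2 ?_).symm
          exact (hker _).2 hc))
    refine ⟨s, ρ, LinearMap.ext fun t => ?_⟩
    change (LinearEquiv.ofInjective j hj).symm _ = t
    rw [LinearEquiv.symm_apply_eq]
    rfl
  obtain ⟨s, ρ, hsρ⟩ := hretract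
  -- Two dimension shifts pass from L to its second syzygy, of which L is a summand. Vanishing
  -- therefore descends by two degrees, and from the odd degree 2d + 1 it reaches degree 1.
  have step : ∀ i : ℕ, Subsingleton (CategoryTheory.Abelian.Ext (ModuleCat.of R L) Y (i + 3)) →
      Subsingleton (CategoryTheory.Abelian.Ext (ModuleCat.of R L) Y (i + 1)) := by
    intro i h
    refine subsingleton_ext_of_retract (ModuleCat.ofHom s) (ModuleCat.ofHom ρ) ?_
      (subsingleton_ext_ker hf₂ (subsingleton_ext_ker hf₁ h))
    rw [← ModuleCat.ofHom_comp, hsρ]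
    rfl
  have hodd : ∀ k : ℕ, Subsingleton (CategoryTheory.Abelian.Ext (ModuleCat.of R L) Y (2 * k + 1)) →
      Subsingleton (CategoryTheory.Abelian.Ext (ModuleCat.of R L) Y 1) := by
    intro k
    induction k with
    | zero => exact id
    | succ k ih => exact fun h => ih (step (2 * k) h)
  have h1 := hodd d (CategoryTheory.HasInjectiveDimensionLT.subsingleton.{u} Y (d + 1)
    (2 * d + 1) (by omega) (ModuleCat.of R L))
  -- The homomorphism φ on (x, y) = ann z is given by x ↦ y, y ↦ y'; `hmap` makes it well defined.
  let g' : R × R →ₗ[R] R :=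
    (LinearMap.toSpanSingleton R R y).coprod (LinearMap.toSpanSingleton R R y')
  have hle : LinearMap.ker f₂ ≤ LinearMap.ker g' := by
    rintro ⟨a, b⟩ hab
    exact hmap a b ((hker₂ _).1 hab)
  let φ : LinearMap.ker f₁ →ₗ[R] R := ((LinearMap.ker f₂).liftQ g' hle).comp
    (f₂.quotKerEquivOfSurjective hf₂).symm.toLinearMap
  obtain ⟨ψ, hψ⟩ := exists_extension_of_subsingleton_ext_one hf₁ h1 φ
  have hφ : φ (f₂ (1, 0)) = y := by
    have : (f₂.quotKerEquivOfSurjective hf₂).symm (f₂ (1, 0)) =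
        (LinearMap.ker f₂).mkQ (1, 0) := by
      rw [LinearEquiv.symm_apply_eq]
      rfl
    change (LinearMap.ker f₂).liftQ g' hle ((f₂.quotKerEquivOfSurjective hf₂).symm (f₂ (1, 0))) = y
    rw [this]
    change (1 : R) * y + 0 * y' = y
    ring
  -- An extension ψ to R is multiplication by ψ 1, so y = φ(x) would be a multiple of x.
  refine hy (ψ 1) ?_
  rw [← hφ, ← hψ]
  have hx : ((f₂ (1, 0) : LinearMap.ker f₁) : R) = x • (1 : R) := by
    change (1 : R) * x + 0 * y = x * 1
    ring
  rw [hx, map_smul, smul_eq_mul, mul_comm]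

/-! ### Power series presentations and Weierstrass division. -/

open PowerSeries in
/-- The plane curve singularity `Y² = X^m`, as a free module over `ℂ[[X]]` with basis `1, Y`. -/
abbrev DoubleCover (m : ℕ) : Type :=
  QuadraticAlgebra ℂ⟦X⟧ ((X : ℂ⟦X⟧) ^ m) 0

section Presentations

open PowerSeries

noncomputable def PowerSeries.mapAlgEquiv {R A B : Type*} [CommSemiring R] [Semiring A]
    [Semiring B] [Algebra R A] [Algebra R B] (e : A ≃ₐ[R] B) : A⟦X⟧ ≃ₐ[R] B⟦X⟧ :=
  AlgEquiv.ofAlgHom (mapAlgHom (e : A →ₐ[R] B)) (mapAlgHom (e.symm : B →ₐ[R] A))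
    (by ext f n; simp [mapAlgHom_apply]) (by ext f n; simp [mapAlgHom_apply])

theorem PowerSeries.mapAlgEquiv_apply {R A B : Type*} [CommSemiring R] [Semiring A]
    [Semiring B] [Algebra R A] [Algebra R B] (e : A ≃ₐ[R] B) (f : A⟦X⟧) :
    mapAlgEquiv e f = f.map ((e : A →ₐ[R] B) : A →+* B) :=
  mapAlgHom_apply (e : A →ₐ[R] B) f

noncomputable def PowerSeries.constantCoeffAlgHom (R A : Type*) [CommSemiring R] [CommSemiring A]
    [Algebra R A] : A⟦X⟧ →ₐ[R] A :=
  { constantCoeff (R := A) with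
    commutes' := fun r => by
      change constantCoeff (algebraMap R A⟦X⟧ r) = _
      rw [algebraMap_apply, constantCoeff_C] }

/-- Power series in two variables as power series in the first variable. -/
noncomputable def planeEquiv : MvPowerSeries (Fin 2) ℂ ≃ₐ[ℂ] ℂ⟦X⟧⟦X⟧ :=
  (MvPowerSeries.finSuccEquiv ℂ 1).trans
    (mapAlgEquiv (MvPowerSeries.renameEquiv ℂ (Equiv.ofUnique (Fin 1) Unit)))

theorem planeEquiv_X_zero : planeEquiv (MvPowerSeries.X 0) = X := by
  rw [planeEquiv, AlgEquiv.trans_apply, MvPowerSeries.finSuccEquiv_X_zero, mapAlgEquiv_apply, map_X]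

theorem planeEquiv_X_one : planeEquiv (MvPowerSeries.X 1) = C X := by
  rw [planeEquiv, AlgEquiv.trans_apply, show (1 : Fin 2) = Fin.succ 0 from rfl,
    MvPowerSeries.finSuccEquiv_X_succ, mapAlgEquiv_apply, map_C]
  congr 1
  exact MvPowerSeries.rename_X _ _

/-- Power series in two variables as power series in the second variable. -/
noncomputable def planeEquivSwap : MvPowerSeries (Fin 2) ℂ ≃ₐ[ℂ] ℂ⟦X⟧⟦X⟧ :=
  (MvPowerSeries.renameEquiv ℂ (Equiv.swap 0 1)).trans planeEquiv

theorem planeEquivSwap_X_zero : planeEquivSwap (MvPowerSeries.X 0) = C X := by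
  rw [← planeEquiv_X_one]
  exact congrArg planeEquiv (MvPowerSeries.rename_X _ _)

theorem planeEquivSwap_X_one : planeEquivSwap (MvPowerSeries.X 1) = X := by
  rw [← planeEquiv_X_zero]
  exact congrArg planeEquiv (MvPowerSeries.rename_X _ _)

/-- Power series in three variables as iterated power series, the last variable being outermost. -/
noncomputable def spaceEquiv : MvPowerSeries (Fin 3) ℂ ≃ₐ[ℂ] ℂ⟦X⟧⟦X⟧⟦X⟧ :=
  (MvPowerSeries.renameEquiv ℂ Fin.revPerm).trans
    ((MvPowerSeries.finSuccEquiv ℂ 2).trans (mapAlgEquiv planeEquiv))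

theorem spaceEquiv_X_two : spaceEquiv (MvPowerSeries.X 2) = X := by
  have h : MvPowerSeries.renameEquiv ℂ Fin.revPerm (MvPowerSeries.X (2 : Fin 3)) =
      MvPowerSeries.X (0 : Fin 3) := MvPowerSeries.rename_X _ _
  rw [spaceEquiv, AlgEquiv.trans_apply, AlgEquiv.trans_apply, h,
    MvPowerSeries.finSuccEquiv_X_zero, mapAlgEquiv_apply, map_X]

theorem spaceEquiv_X_one : spaceEquiv (MvPowerSeries.X 1) = C X := by
  have h : MvPowerSeries.renameEquiv ℂ Fin.revPerm (MvPowerSeries.X (1 : Fin 3)) =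
      MvPowerSeries.X (Fin.succ 0 : Fin 3) := MvPowerSeries.rename_X _ _
  rw [spaceEquiv, AlgEquiv.trans_apply, AlgEquiv.trans_apply, h,
    MvPowerSeries.finSuccEquiv_X_succ, mapAlgEquiv_apply, map_C]
  exact congrArg C planeEquiv_X_zero

theorem spaceEquiv_X_zero : spaceEquiv (MvPowerSeries.X 0) = C (C X) := by
  have h : MvPowerSeries.renameEquiv ℂ Fin.revPerm (MvPowerSeries.X (0 : Fin 3)) =
      MvPowerSeries.X (Fin.succ 1 : Fin 3) := MvPowerSeries.rename_X _ _
  rw [spaceEquiv, AlgEquiv.trans_apply, AlgEquiv.trans_apply, h,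
    MvPowerSeries.finSuccEquiv_X_succ, mapAlgEquiv_apply, map_C]
  exact congrArg C planeEquiv_X_one

theorem isDistinguishedAt_X_sq_sub {m : ℕ} (hm : 1 ≤ m) :
    (Polynomial.X ^ 2 - Polynomial.C ((X : ℂ⟦X⟧) ^ m)).IsDistinguishedAt
      (Ideal.span {(X : ℂ⟦X⟧)}) := by
  refine ⟨⟨fun {n} hn => ?_⟩, Polynomial.monic_X_pow_sub_C _ two_ne_zero⟩
  rw [Polynomial.natDegree_X_pow_sub_C] at hn
  rw [Polynomial.coeff_sub, Polynomial.coeff_X_pow, if_neg hn.ne, zero_sub, neg_mem_iff,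
    Polynomial.coeff_C]
  split_ifs
  · exact Ideal.mem_span_singleton.2 (dvd_pow_self _ (by omega))
  · exact zero_mem _

/-- The remainder of p on division by the monic quadratic is c₀ + c₁Y, and its value at ω has
coordinates (c₀, c₁). -/
theorem aeval_omega_eq_zero_iff (m : ℕ) (p : Polynomial ℂ⟦X⟧) :
    Polynomial.aeval (QuadraticAlgebra.omega : DoubleCover m) p = 0 ↔
      Polynomial.X ^ 2 - Polynomial.C (X ^ m) ∣ p := by
  set g : Polynomial ℂ⟦X⟧ := Polynomial.X ^ 2 - Polynomial.C (X ^ m) with hg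
  have hmon : g.Monic := Polynomial.monic_X_pow_sub_C _ two_ne_zero
  have h0 : Polynomial.aeval (QuadraticAlgebra.omega : DoubleCover m) g = 0 := by
    rw [hg, map_sub, map_pow, Polynomial.aeval_X, Polynomial.aeval_C, pow_two,
      QuadraticAlgebra.omega_mul_omega_eq_mk]
    exact sub_self _
  have hdeg : (p %ₘ g).natDegree < 2 := by
    have h2 : g.natDegree = 2 := Polynomial.natDegree_X_pow_sub_C
    rw [← h2]
    refine Polynomial.natDegree_modByMonic_lt p hmon fun h => ?_
    rw [h, Polynomial.natDegree_one] at h2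
    exact two_ne_zero h2.symm
  have hsum := (p %ₘ g).as_sum_range' 2 hdeg
  have h1 : Polynomial.aeval (QuadraticAlgebra.omega : DoubleCover m) p =
      ⟨(p %ₘ g).coeff 0, (p %ₘ g).coeff 1⟩ := by
    conv_lhs => rw [← Polynomial.modByMonic_add_div p g, map_add, map_mul, h0, zero_mul,
      add_zero, hsum]
    simp [Finset.sum_range_succ, Polynomial.aeval_monomial]
    ext <;> simp
  constructor
  · intro h
    rw [h] at h1
    rw [← Polynomial.modByMonic_eq_zero_iff_dvd hmon]
    have h2 := congrArg QuadraticAlgebra.re h1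
    have h3 := congrArg QuadraticAlgebra.im h1
    dsimp at h2 h3
    rw [hsum, Finset.sum_range_succ, Finset.sum_range_one, ← h2, ← h3, map_zero, map_zero, add_zero]
  · rintro ⟨q, rfl⟩
    rw [map_mul, h0, zero_mul]

theorem Polynomial.IsDistinguishedAt.exists_ringEquiv {A : Type*} [CommRing A] {g : Polynomial A}
    {I : Ideal A} [IsAdicComplete I A] (H : g.IsDistinguishedAt I) :
    ∃ e : (Polynomial A ⧸ Ideal.span {g}) ≃+* A⟦X⟧ ⧸ Ideal.span {(g : A⟦X⟧)},
      ∀ p : Polynomial A, e (Ideal.Quotient.mk _ p) = Ideal.Quotient.mk _ (p : A⟦X⟧) :=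
  ⟨H.algEquivQuotient.toRingEquiv, fun _ => rfl⟩

/-- Weierstrass division by the distinguished polynomial Y² - X^m identifies the quotient of power
series with the quotient of polynomials. For m = 0 this fails, since Y² - 1 is a unit among power
series. -/
theorem exists_weierstrass_algHom {m : ℕ} (hm : 1 ≤ m) :
    ∃ ψ : ℂ⟦X⟧⟦X⟧ →ₐ[ℂ] DoubleCover m, ψ X = QuadraticAlgebra.omega ∧ (∀ a, ψ (C a) = ⟨a, 0⟩) ∧
      ∀ f, ψ f = 0 ↔ X ^ 2 - C (X ^ m) ∣ f := by
  set g : Polynomial ℂ⟦X⟧ := Polynomial.X ^ 2 - Polynomial.C (X ^ m) with hg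
  have hgc : (g : ℂ⟦X⟧⟦X⟧) = X ^ 2 - C (X ^ m) := by
    rw [hg, Polynomial.coe_sub, Polynomial.coe_pow, Polynomial.coe_X, Polynomial.coe_C]
  obtain ⟨e, he⟩ := (isDistinguishedAt_X_sq_sub hm).exists_ringEquiv
  let F : (Polynomial ℂ⟦X⟧ ⧸ Ideal.span {g}) →ₐ[ℂ⟦X⟧] DoubleCover m :=
    Ideal.Quotient.liftₐ _ (Polynomial.aeval QuadraticAlgebra.omega) fun p hp =>
      (aeval_omega_eq_zero_iff m p).2 (Ideal.mem_span_singleton.1 hp)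
  have hF : Function.Injective F := by
    rw [injective_iff_map_eq_zero]
    intro p hp
    obtain ⟨p, rfl⟩ := Ideal.Quotient.mk_surjective p
    exact Ideal.Quotient.eq_zero_iff_mem.2
      (Ideal.mem_span_singleton.2 ((aeval_omega_eq_zero_iff m p).1 hp))
  let ψ : ℂ⟦X⟧⟦X⟧ →+* DoubleCover m := (F : _ →+* DoubleCover m).comp
    (e.symm.toRingHom.comp (Ideal.Quotient.mk _))
  have hψ : ∀ p : Polynomial ℂ⟦X⟧, ψ p = Polynomial.aeval QuadraticAlgebra.omega p := by
    intro p
    change F (e.symm (Ideal.Quotient.mk _ (p : ℂ⟦X⟧⟦X⟧))) = _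
    rw [← he, e.symm_apply_apply]
    rfl
  have hC : ∀ a, ψ (C a) = ⟨a, 0⟩ := fun a => by
    rw [← Polynomial.coe_C, hψ, Polynomial.aeval_C]
    rfl
  refine ⟨{ ψ with commutes' := fun c => (congrArg ψ algebraMap_apply).trans (hC _) }, ?_, hC,
    fun f => ?_⟩
  · have hX := hψ Polynomial.X
    rwa [Polynomial.coe_X, Polynomial.aeval_X] at hX
  · change F (e.symm (Ideal.Quotient.mk _ f)) = 0 ↔ _
    rw [map_eq_zero_iff F hF, map_eq_zero_iff e.symm e.symm.injective,
      Ideal.Quotient.eq_zero_iff_mem, Ideal.mem_span_singleton, hgc]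

/-- The residue class of a power series in `X` and `Y` modulo `Y² = X^m`. -/
noncomputable def residueDouble {m : ℕ} (hm : 1 ≤ m) : ℂ⟦X⟧⟦X⟧ →ₐ[ℂ] DoubleCover m :=
  (exists_weierstrass_algHom hm).choose

section residueDouble

variable {m : ℕ} (hm : 1 ≤ m)

theorem residueDouble_X : residueDouble hm X = QuadraticAlgebra.omega :=
  (exists_weierstrass_algHom hm).choose_spec.1

theorem residueDouble_eq_zero_iff (f : ℂ⟦X⟧⟦X⟧) :
    residueDouble hm f = 0 ↔ X ^ 2 - C (X ^ m) ∣ f :=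
  (exists_weierstrass_algHom hm).choose_spec.2.2 f

theorem residueDouble_C (a : ℂ⟦X⟧) : residueDouble hm (C a) = ⟨a, 0⟩ :=
  (exists_weierstrass_algHom hm).choose_spec.2.1 a

theorem residueDouble_linear (a b : ℂ⟦X⟧) : residueDouble hm (C a + C b * X) = ⟨a, b⟩ := by
  rw [map_add, map_mul, residueDouble_C, residueDouble_C, residueDouble_X]
  ext <;> simp

theorem residueDouble_surjective : Function.Surjective (residueDouble hm) := fun z =>
  ⟨C z.re + C z.im * X, residueDouble_linear hm z.re z.im⟩

theorem exists_eq_add_mul (f : ℂ⟦X⟧⟦X⟧) : ∃ q, f =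
    C (residueDouble hm f).re + C (residueDouble hm f).im * X + (X ^ 2 - C (X ^ m)) * q := by
  obtain ⟨q, hq⟩ := (residueDouble_eq_zero_iff hm
    (f - (C (residueDouble hm f).re + C (residueDouble hm f).im * X))).1 (by
      rw [map_sub, residueDouble_linear]
      exact sub_self _)
  exact ⟨q, by rw [← hq]; ring⟩

/-- Restriction to the line `X = 0`. -/
noncomputable def restrictLine : ℂ⟦X⟧⟦X⟧ →ₐ[ℂ] ℂ⟦X⟧ :=
  mapAlgHom (constantCoeffAlgHom ℂ ℂ)

theorem coeff_restrictLine (f : ℂ⟦X⟧⟦X⟧) (i : ℕ) :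
    coeff i (restrictLine f) = constantCoeff (coeff i f) := by
  rw [restrictLine, mapAlgHom_apply, coeff_map]
  rfl

theorem restrictLine_X : restrictLine X = X := by
  rw [restrictLine, mapAlgHom_apply, map_X]

theorem restrictLine_C (a : ℂ⟦X⟧) : restrictLine (C a) = C (constantCoeff a) := by
  rw [restrictLine, mapAlgHom_apply, map_C]
  rfl

theorem restrictLine_map_C (a : ℂ⟦X⟧) : restrictLine (map C a) = a := by
  ext i
  rw [coeff_restrictLine, coeff_map, constantCoeff_C]

theorem restrictLine_eq_zero_iff (f : ℂ⟦X⟧⟦X⟧) : restrictLine f = 0 ↔ C X ∣ f := by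
  constructor
  · intro h
    have h1 : ∀ i, X ∣ coeff i f := fun i => by
      rw [X_dvd_iff, ← coeff_restrictLine, h, map_zero]
    choose g hg using h1
    refine ⟨mk g, ?_⟩
    ext1 i
    rw [coeff_C_mul, coeff_mk, hg]
  · rintro ⟨g, rfl⟩
    rw [map_mul, restrictLine_C, constantCoeff_X, map_zero, zero_mul]

/-- Setting X = 0 in f = a + bY + (Y² - X^m)q gives a(0) + b(0)Y + Y²q(0, Y). This and the next
lemma compare the constant and linear terms on the line with the residue on the double cover; they
are the only conditions tying the two together. -/
theorem coeff_zero_restrictLine (f : ℂ⟦X⟧⟦X⟧) :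
    constantCoeff (restrictLine f) = constantCoeff (residueDouble hm f).re := by
  obtain ⟨q, hq⟩ := exists_eq_add_mul hm f
  have h := congrArg (fun g => constantCoeff (restrictLine g)) hq
  simpa [restrictLine_X, restrictLine_C, zero_pow (by omega : m ≠ 0)] using h

theorem coeff_one_restrictLine (f : ℂ⟦X⟧⟦X⟧) :
    coeff 1 (restrictLine f) = constantCoeff (residueDouble hm f).im := by
  obtain ⟨q, hq⟩ := exists_eq_add_mul hm f
  have h := congrArg (fun g => coeff 1 (restrictLine g)) hq
  simpa [restrictLine_X, restrictLine_C, zero_pow (by omega : m ≠ 0), coeff_C, coeff_X_pow_mul']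
    using h

end residueDouble

end Presentations

/-! ### Models of the singularities as subrings of the normalization. -/

section Models

open PowerSeries

/-- The disjoint union of `Y² = X^m` and a line. For `m = 0, 1` this is the normalization of the
singularities of type `D`. -/
abbrev DoubleCoverLine (m : ℕ) : Type :=
  DoubleCover m × ℂ⟦X⟧

/-- The partial normalization of the double cover `u² = X^m` given by `X^(l) u`. -/
noncomputable def scaleDouble {k : ℕ} (l m : ℕ) (h : k = 2 * l + m) :
    DoubleCover k →ₐ[ℂ] DoubleCover m where
  toFun z := ⟨z.re, X ^ l * z.im⟩
  map_one' := QuadraticAlgebra.ext rfl (mul_zero _)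
  map_mul' z w := by
    subst h
    ext1 <;> simp <;> ring
  map_zero' := QuadraticAlgebra.ext rfl (mul_zero _)
  map_add' z w := QuadraticAlgebra.ext rfl (mul_add _ _ _)
  commutes' c := by
    change (⟨_, X ^ l * 0⟩ : DoubleCover m) = _
    rw [mul_zero]
    rfl

theorem scaleDouble_apply {k : ℕ} (l m : ℕ) (h : k = 2 * l + m) (z : DoubleCover k) :
    scaleDouble l m h z = ⟨z.re, X ^ l * z.im⟩ :=
  rfl

theorem scaleDouble_injective {k : ℕ} (l m : ℕ) (h : k = 2 * l + m) :
    Function.Injective (scaleDouble l m h) := by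
  intro z w h
  rw [scaleDouble_apply, scaleDouble_apply, QuadraticAlgebra.ext_iff] at h
  exact QuadraticAlgebra.ext h.1 (mul_left_cancel₀ (pow_ne_zero l X_ne_zero) h.2)

/-- The disjoint union of the curve `Y² = X^(2l+m)` and a line. -/
noncomputable def disjointRing (m l : ℕ) : Subalgebra ℂ (DoubleCoverLine m) where
  carrier := {x | X ^ l ∣ x.1.im}
  mul_mem' := by
    intro x y hx hy
    change X ^ l ∣ (x.1 * y.1).im
    rw [QuadraticAlgebra.im_mul, zero_mul, zero_mul, add_zero]
    exact dvd_add (dvd_mul_of_dvd_right hy _) (dvd_mul_of_dvd_left hx _)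
  add_mem' := fun hx hy => dvd_add hx hy
  algebraMap_mem' := fun c => dvd_zero _

theorem mem_disjointRing {m l : ℕ} {x : DoubleCoverLine m} :
    x ∈ disjointRing m l ↔ X ^ l ∣ x.1.im :=
  Iff.rfl

/-- The transversal union of the curve `Y² = X^(2l+2+m)` and a line. -/
noncomputable def gluedRing (m l : ℕ) : Subalgebra ℂ (DoubleCoverLine m) where
  carrier := {x | X ^ (l + 1) ∣ x.1.im ∧ constantCoeff x.1.re = constantCoeff x.2}
  mul_mem' := by
    rintro x y ⟨hx, hx'⟩ ⟨hy, hy'⟩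
    refine ⟨(disjointRing m (l + 1)).mul_mem hx hy, ?_⟩
    have h : constantCoeff x.1.im = 0 := X_dvd_iff.1 ((dvd_pow_self X l.succ_ne_zero).trans hx)
    change constantCoeff (x.1 * y.1).re = constantCoeff (x.2 * y.2)
    simp [hx', hy', h]
  add_mem' := by
    rintro x y ⟨hx, hx'⟩ ⟨hy, hy'⟩
    exact ⟨dvd_add hx hy, by
      change constantCoeff (x.1.re + y.1.re) = constantCoeff (x.2 + y.2)
      rw [map_add, map_add, hx', hy']⟩
  algebraMap_mem' := fun c => ⟨dvd_zero _, rfl⟩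

theorem mem_gluedRing {m l : ℕ} {x : DoubleCoverLine m} :
    x ∈ gluedRing m l ↔ X ^ (l + 1) ∣ x.1.im ∧ constantCoeff x.1.re = constantCoeff x.2 :=
  Iff.rfl

theorem coeff_mul_of_X_pow_dvd {R : Type*} [CommSemiring R] {l : ℕ} (f : R⟦X⟧) {g : R⟦X⟧}
    (hg : X ^ l ∣ g) : coeff l (f * g) = constantCoeff f * coeff l g := by
  obtain ⟨g, rfl⟩ := hg
  rw [mul_left_comm, coeff_X_pow_mul', coeff_X_pow_mul', if_pos le_rfl, Nat.sub_self]
  simp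

theorem coeff_one_mul_of (f g : ℂ⟦X⟧) :
    coeff 1 (f * g) = constantCoeff f * coeff 1 g + coeff 1 f * constantCoeff g := by
  rw [coeff_mul, Finset.Nat.sum_antidiagonal_succ]
  simp

/-- The union of the curve `Y² = X^(2l+2+m)` and the line `X = 0` in the plane. -/
noncomputable def tangentRing (m l : ℕ) : Subalgebra ℂ (DoubleCoverLine m) where
  carrier := {x | x ∈ gluedRing m l ∧ coeff (l + 1) x.1.im = coeff 1 x.2}
  mul_mem' := by
    rintro x y ⟨hx, hx'⟩ ⟨hy, hy'⟩
    refine ⟨(gluedRing m l).mul_mem hx hy, ?_⟩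
    change coeff (l + 1) (x.1 * y.1).im = coeff 1 (x.2 * y.2)
    rw [QuadraticAlgebra.im_mul, zero_mul, zero_mul, add_zero, map_add,
      coeff_mul_of_X_pow_dvd _ hy.1, mul_comm x.1.im, coeff_mul_of_X_pow_dvd _ hx.1,
      coeff_one_mul_of, hx', hy', hx.2, hy.2, mul_comm (constantCoeff y.2)]
  add_mem' := by
    rintro x y ⟨hx, hx'⟩ ⟨hy, hy'⟩
    exact ⟨(gluedRing m l).add_mem hx hy, by
      change coeff (l + 1) (x.1.im + y.1.im) = coeff 1 (x.2 + y.2)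
      rw [map_add, map_add, hx', hy']⟩
  algebraMap_mem' := fun c => ⟨(gluedRing m l).algebraMap_mem c, by
    change coeff (l + 1) 0 = coeff 1 (C c)
    rw [coeff_C, if_neg one_ne_zero, map_zero]⟩

theorem mem_tangentRing {m l : ℕ} {x : DoubleCoverLine m} :
    x ∈ tangentRing m l ↔ x ∈ gluedRing m l ∧ coeff (l + 1) x.1.im = coeff 1 x.2 :=
  Iff.rfl

theorem nonempty_quotient_algEquiv {M B : Type*} [CommRing M] [Algebra ℂ M] [CommRing B]
    [Algebra ℂ B] (f : M →ₐ[ℂ] B) (I : Ideal M) (hI : ∀ x, f x = 0 ↔ x ∈ I) (S : Subalgebra ℂ B)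
    (hS : ∀ b, b ∈ S ↔ ∃ x, f x = b) : Nonempty ((M ⧸ I) ≃ₐ[ℂ] S) := by
  have hker : I = RingHom.ker f := by
    ext x
    rw [RingHom.mem_ker, hI]
  have hrange : f.range = S := by
    ext b
    rw [hS]
    rfl
  subst hker hrange
  exact ⟨Ideal.quotientKerEquivRange f⟩

theorem nonempty_singA_algEquiv (k : ℕ) : Nonempty (SingA k ≃ₐ[ℂ] DoubleCover (k + 1)) := by
  obtain ⟨e⟩ := nonempty_quotient_algEquiv
    ((residueDouble k.succ_pos).comp (planeEquiv : MvPowerSeries (Fin 2) ℂ →ₐ[ℂ] ℂ⟦X⟧⟦X⟧))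
    (Ideal.span {(MvPowerSeries.X 0 ^ 2 - MvPowerSeries.X 1 ^ (k + 1) : MvPowerSeries (Fin 2) ℂ)})
    (fun x => by
      change residueDouble _ (planeEquiv x) = 0 ↔ _
      rw [residueDouble_eq_zero_iff, Ideal.mem_span_singleton, ← map_dvd_iff planeEquiv, map_sub,
        map_pow planeEquiv, map_pow planeEquiv, planeEquiv_X_zero, planeEquiv_X_one, map_pow])
    ⊤ (fun b => by
      refine ⟨fun _ => ?_, fun _ => trivial⟩
      obtain ⟨f, hf⟩ := residueDouble_surjective k.succ_pos b
      exact ⟨planeEquiv.symm f, by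
        change residueDouble _ (planeEquiv _) = _
        rw [planeEquiv.apply_symm_apply, hf]⟩)
  exact ⟨e.trans Subalgebra.topEquiv⟩

theorem nonempty_disjointRing_algEquiv (m l : ℕ) :
    Nonempty (disjointRing m l ≃ₐ[ℂ] DoubleCover (2 * l + m) × ℂ⟦X⟧) := by
  let f : DoubleCover (2 * l + m) × ℂ⟦X⟧ →ₐ[ℂ] DoubleCoverLine m :=
    (scaleDouble l m rfl).prodMap (AlgHom.id ℂ ℂ⟦X⟧)
  have hf : Function.Injective f := (scaleDouble_injective l m rfl).prodMap Function.injective_id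
  have hrange : f.range = disjointRing m l := by
    ext ⟨⟨a, b⟩, g⟩
    rw [mem_disjointRing]
    constructor
    · rintro ⟨⟨z, g'⟩, hz⟩
      have h := congrArg (fun x : DoubleCoverLine m => x.1.im) hz
      exact ⟨z.im, h.symm⟩
    · rintro ⟨b', hb⟩
      exact ⟨⟨⟨a, b'⟩, g⟩, Prod.ext (QuadraticAlgebra.ext rfl hb.symm) rfl⟩
  exact ⟨((AlgEquiv.ofInjective f hf).trans (Subalgebra.equivOfEq _ _ hrange)).symm⟩

theorem smul_double_eq_zero {m : ℕ} {z : DoubleCover m} (h : ⟨X, 0⟩ * z = 0) : z = 0 := by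
  rw [QuadraticAlgebra.ext_iff] at h
  simpa [QuadraticAlgebra.ext_iff, X_ne_zero] using h

/-- A series vanishing on X = 0 has the form Xh, and X is a non-zerodivisor on the double cover, so
vanishing on both components means divisibility by the product of their equations. -/
theorem nonempty_singD_algEquiv (m l : ℕ) :
    Nonempty (SingD (2 * (l + 1) + m + 2) ≃ₐ[ℂ] tangentRing m l) := by
  have hm : 1 ≤ 2 * (l + 1) + m := by omega
  let F : ℂ⟦X⟧⟦X⟧ →ₐ[ℂ] DoubleCoverLine m :=
    ((scaleDouble (l + 1) m rfl).comp (residueDouble hm)).prod restrictLine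
  have hF : ∀ f, F f = (⟨(residueDouble hm f).re, X ^ (l + 1) * (residueDouble hm f).im⟩,
    restrictLine f) := fun f => rfl
  refine nonempty_quotient_algEquiv
    (F.comp (planeEquivSwap : MvPowerSeries (Fin 2) ℂ →ₐ[ℂ] ℂ⟦X⟧⟦X⟧)) _ (fun x => ?_) _ ?_
  · change (scaleDouble (l + 1) m rfl (residueDouble hm (planeEquivSwap x)),
      restrictLine (planeEquivSwap x)) = 0 ↔ _
    rw [Ideal.mem_span_singleton, ← map_dvd_iff planeEquivSwap, map_mul, map_sub, map_pow, map_pow,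
      planeEquivSwap_X_zero, planeEquivSwap_X_one, Prod.mk_eq_zero,
      map_eq_zero_iff _ (scaleDouble_injective _ _ rfl), Nat.add_sub_cancel, ← map_pow]
    constructor
    · rintro ⟨h1, h2⟩
      obtain ⟨h, hh⟩ := (restrictLine_eq_zero_iff _).1 h2
      rw [hh, map_mul, residueDouble_C] at h1
      rw [hh]
      exact mul_dvd_mul_left _ ((residueDouble_eq_zero_iff hm h).1 (smul_double_eq_zero h1))
    · intro h
      exact ⟨(residueDouble_eq_zero_iff hm _).2 ((dvd_mul_left _ _).trans h),
        (restrictLine_eq_zero_iff _).2 ((dvd_mul_right _ _).trans h)⟩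
  · rintro ⟨⟨a, b⟩, g⟩
    rw [mem_tangentRing, mem_gluedRing]
    constructor
    · rintro ⟨⟨⟨b, rfl⟩, h2⟩, h3⟩
      dsimp only at h2 h3
      rw [coeff_X_pow_mul', if_pos le_rfl, Nat.sub_self, coeff_zero_eq_constantCoeff] at h3
      -- The two matching conditions give g = a(0) + b(0)Y + Y²h. The preimage is a + bY + (Y² -
      -- X^(n-2))h(Y): the last term vanishes on the double cover and corrects the terms of order at
      -- least two on the line.
      have hq : X ^ 2 ∣ g - (C (constantCoeff a) + C (constantCoeff b) * X) := by
        rw [X_pow_dvd_iff]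
        intro i hi
        interval_cases i
        · simp [h2]
        · simp [h3, coeff_C]
      obtain ⟨h, hh⟩ := hq
      have hres : residueDouble hm
          (C a + C b * X + (X ^ 2 - C (X ^ (2 * (l + 1) + m))) * map C h) = ⟨a, b⟩ := by
        rw [map_add, residueDouble_linear, map_mul, (residueDouble_eq_zero_iff hm _).2 dvd_rfl,
          zero_mul, add_zero]
      refine ⟨planeEquivSwap.symm
        (C a + C b * X + (X ^ 2 - C (X ^ (2 * (l + 1) + m))) * map C h), ?_⟩
      change F (planeEquivSwap _) = _
      rw [planeEquivSwap.apply_symm_apply, hF, hres]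
      refine Prod.ext rfl ?_
      rw [map_add, map_mul, map_sub, map_pow, restrictLine_map_C, map_add, map_mul, restrictLine_X,
        restrictLine_C, restrictLine_C, restrictLine_C, map_pow, constantCoeff_X,
        zero_pow (by omega), map_zero, sub_zero, ← hh]
      ring
    · rintro ⟨x, hx⟩
      change F (planeEquivSwap x) = _ at hx
      rw [hF] at hx
      rw [← hx]
      refine ⟨⟨dvd_mul_right _ _, (coeff_zero_restrictLine hm _).symm⟩, ?_⟩
      dsimp only
      rw [coeff_X_pow_mul', if_pos le_rfl, Nat.sub_self, coeff_zero_eq_constantCoeff,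
        coeff_one_restrictLine hm]

end Models

/-! ### The space curve A_k ∨ L. -/

section SpaceCurve

open PowerSeries

/-- Restriction to the line `X = Y = 0`. -/
noncomputable def restrictAxis : ℂ⟦X⟧⟦X⟧⟦X⟧ →ₐ[ℂ] ℂ⟦X⟧ :=
  mapAlgHom ((constantCoeffAlgHom ℂ ℂ).comp (constantCoeffAlgHom ℂ ℂ⟦X⟧))

theorem coeff_restrictAxis (f : ℂ⟦X⟧⟦X⟧⟦X⟧) (i : ℕ) :
    coeff i (restrictAxis f) = constantCoeff (constantCoeff (coeff i f)) := by
  rw [restrictAxis, mapAlgHom_apply, coeff_map]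
  rfl

theorem restrictAxis_X : restrictAxis X = X := by
  rw [restrictAxis, mapAlgHom_apply, map_X]

theorem restrictAxis_C (a : ℂ⟦X⟧⟦X⟧) :
    restrictAxis (C a) = C (constantCoeff (constantCoeff a)) := by
  rw [restrictAxis, mapAlgHom_apply, map_C]
  rfl

theorem restrictAxis_map (g : ℂ⟦X⟧) : restrictAxis (map (C.comp C) g) = g := by
  ext i
  rw [coeff_restrictAxis, coeff_map, RingHom.comp_apply, constantCoeff_C, constantCoeff_C]

theorem restrictAxis_eq_zero_iff (f : ℂ⟦X⟧⟦X⟧⟦X⟧) :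
    restrictAxis f = 0 ↔ ∃ a b, f = a * C (C X) + b * C X := by
  constructor
  · intro h
    have h1 : ∀ i, ∃ a b, coeff i f = a * C X + b * X := fun i => by
      have h2 : constantCoeff (constantCoeff (coeff i f)) = 0 := by
        rw [← coeff_restrictAxis, h, map_zero]
      obtain ⟨a, ha⟩ := X_dvd_iff.2 h2
      obtain ⟨b, hb⟩ := X_dvd_iff.2 (show
        constantCoeff (coeff i f - C (constantCoeff (coeff i f))) = 0 by rw [map_sub, constantCoeff_C, sub_self])
      refine ⟨C a, b, ?_⟩
      rw [← map_mul, mul_comm a, ← ha, mul_comm b, ← hb]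
      ring
    choose a b hab using h1
    refine ⟨mk a, mk b, ?_⟩
    ext1 i
    rw [map_add, coeff_mul_C, coeff_mul_C, coeff_mk, coeff_mk, hab]
  · rintro ⟨a, b, rfl⟩
    rw [map_add, map_mul, map_mul, restrictAxis_C, restrictAxis_C, constantCoeff_C, constantCoeff_X,
      constantCoeff_X, map_zero, map_zero, mul_zero, map_zero, mul_zero, add_zero]

/-- This computes (Z, Y² - X^m) ∩ (X, Y). Writing f = f(X, Y, 0) + Zg, the first summand is a
multiple of Y² - X^m and so vanishes on the Z-axis; hence Zg vanishes there too, and g ∈ (X, Y). -/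
theorem residue_and_restrictAxis_eq_zero_iff {m : ℕ} (hm : 1 ≤ m) (f : ℂ⟦X⟧⟦X⟧⟦X⟧) :
    residueDouble hm (constantCoeff f) = 0 ∧ restrictAxis f = 0 ↔
      ∃ a b c, f = a * (X * C (C X)) + b * (X * C X) + c * (C X ^ 2 - C (C X) ^ m) := by
  constructor
  · rintro ⟨h1, h2⟩
    obtain ⟨q, hq⟩ := (residueDouble_eq_zero_iff hm _).1 h1
    obtain ⟨g, hg⟩ := X_dvd_iff.2 (show constantCoeff (f - C (constantCoeff f)) = 0 by
      rw [map_sub, constantCoeff_C, sub_self])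
    rw [sub_eq_iff_eq_add] at hg
    have h3 : restrictAxis g = 0 := by
      rw [hg, map_add, map_mul, restrictAxis_X, restrictAxis_C, hq, map_mul, map_sub, map_pow,
        constantCoeff_X, constantCoeff_C, zero_pow two_ne_zero, zero_sub, map_mul, map_neg, map_pow,
        constantCoeff_X, zero_pow (by omega), neg_zero, zero_mul, map_zero, add_zero] at h2
      exact (mul_eq_zero.1 h2).resolve_left X_ne_zero
    obtain ⟨a, b, rfl⟩ := (restrictAxis_eq_zero_iff g).1 h3
    refine ⟨a, b, C q, ?_⟩
    rw [hg, hq, map_mul, map_sub, map_pow, map_pow, map_pow]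
    ring
  · rintro ⟨a, b, c, rfl⟩
    constructor
    · rw [residueDouble_eq_zero_iff]
      refine ⟨constantCoeff c, ?_⟩
      simp only [map_add, map_mul, map_sub, map_pow, constantCoeff_X, constantCoeff_C]
      ring
    · simp [restrictAxis_X, restrictAxis_C, zero_pow (by omega : m ≠ 0)]

theorem mem_maximalMinors_matrixAVeeL {k : ℕ} {f : MvPowerSeries (Fin 3) ℂ} :
    f ∈ maximalMinors (matrixAVeeL k) ↔
      ∃ a b c, f = a * (MvPowerSeries.X 2 * MvPowerSeries.X 0) +
        b * (MvPowerSeries.X 2 * MvPowerSeries.X 1) +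
        c * (MvPowerSeries.X 1 ^ 2 - MvPowerSeries.X 0 ^ (k + 1)) := by
  constructor
  · intro hf
    suffices maximalMinors (matrixAVeeL k) ≤ Ideal.span
        {MvPowerSeries.X 2 * MvPowerSeries.X 0, MvPowerSeries.X 2 * MvPowerSeries.X 1,
          MvPowerSeries.X 1 ^ 2 - MvPowerSeries.X 0 ^ (k + 1)} by
      obtain ⟨a, z, hz, h⟩ := Ideal.mem_span_insert.1 (this hf)
      obtain ⟨b, c, h'⟩ := Ideal.mem_span_pair.1 hz
      exact ⟨a, b, c, by rw [h, ← h', add_assoc]⟩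
    rw [maximalMinors, Ideal.span_le]
    rintro _ ⟨σ, rfl⟩
    simp only [SetLike.mem_coe, Ideal.mem_span_insert, Ideal.mem_span_singleton']
    -- `maximalMinors` allows every pair of columns, including repeated and reversed ones, which
    -- produce the zeros and the signs.
    have key : ∀ i j : Fin 3, ∃ a b c : MvPowerSeries (Fin 3) ℂ,
        matrixAVeeL k 0 i * matrixAVeeL k 1 j - matrixAVeeL k 0 j * matrixAVeeL k 1 i =
        a * (MvPowerSeries.X 2 * MvPowerSeries.X 0) +
        (b * (MvPowerSeries.X 2 * MvPowerSeries.X 1) +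
        c * (MvPowerSeries.X 1 ^ 2 - MvPowerSeries.X 0 ^ (k + 1))) := by
      intro i j
      fin_cases i <;> fin_cases j <;> simp only [matrixAVeeL, Matrix.of_apply, Matrix.cons_val',
        Matrix.cons_val_zero, Matrix.cons_val_one, Matrix.cons_val_fin_one, Fin.zero_eta,
        Fin.mk_one, Fin.reduceFinMk, Matrix.cons_val]
      · exact ⟨0, 0, 0, by ring⟩
      · exact ⟨1, 0, 0, by ring⟩
      · exact ⟨0, 1, 0, by ring⟩
      · exact ⟨-1, 0, 0, by ring⟩
      · exact ⟨0, 0, 0, by ring⟩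
      · exact ⟨0, 0, 1, by ring⟩
      · exact ⟨0, -1, 0, by ring⟩
      · exact ⟨0, 0, -1, by ring⟩
      · exact ⟨0, 0, 0, by ring⟩
    obtain ⟨a, b, c, h⟩ := key (σ 0) (σ 1)
    refine ⟨a, _, ⟨b, _, ⟨c, rfl⟩, rfl⟩, ?_⟩
    rw [← h, Matrix.det_fin_two]
    rfl
  · rintro ⟨a, b, c, rfl⟩
    have hmem : ∀ i j : Fin 3, matrixAVeeL k 0 i * matrixAVeeL k 1 j -
        matrixAVeeL k 0 j * matrixAVeeL k 1 i ∈ maximalMinors (matrixAVeeL k) := fun i j => by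
      refine Ideal.subset_span ⟨![i, j], ?_⟩
      change ((matrixAVeeL k).submatrix id ![i, j]).det = _
      rw [Matrix.det_fin_two]
      rfl
    refine Ideal.add_mem _ (Ideal.add_mem _ (Ideal.mul_mem_left _ _ ?_) (Ideal.mul_mem_left _ _ ?_))
      (Ideal.mul_mem_left _ _ ?_)
    · simpa [matrixAVeeL] using hmem 0 1
    · simpa [matrixAVeeL] using hmem 0 2
    · convert hmem 1 2 using 1
      simp [matrixAVeeL, pow_succ]

variable (k : ℕ)

/-- Restriction of functions on 3-space to the curve `Y² = X^(k+1)`, `Z = 0`. -/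
noncomputable def spaceResidue : MvPowerSeries (Fin 3) ℂ →ₐ[ℂ] DoubleCover (k + 1) :=
  (residueDouble k.succ_pos).comp ((constantCoeffAlgHom ℂ ℂ⟦X⟧⟦X⟧).comp
    (spaceEquiv : MvPowerSeries (Fin 3) ℂ →ₐ[ℂ] ℂ⟦X⟧⟦X⟧⟦X⟧))

/-- Restriction of functions on 3-space to the line `X = Y = 0`. -/
noncomputable def spaceRestrictAxis : MvPowerSeries (Fin 3) ℂ →ₐ[ℂ] ℂ⟦X⟧ :=
  restrictAxis.comp (spaceEquiv : MvPowerSeries (Fin 3) ℂ →ₐ[ℂ] ℂ⟦X⟧⟦X⟧⟦X⟧)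

theorem spaceResidue_symm (f : ℂ⟦X⟧⟦X⟧⟦X⟧) :
    spaceResidue k (spaceEquiv.symm f) = residueDouble k.succ_pos (constantCoeff f) := by
  change residueDouble _ (constantCoeff (spaceEquiv (spaceEquiv.symm f))) = _
  rw [spaceEquiv.apply_symm_apply]

theorem spaceRestrictAxis_symm (f : ℂ⟦X⟧⟦X⟧⟦X⟧) :
    spaceRestrictAxis (spaceEquiv.symm f) = restrictAxis f := by
  change restrictAxis (spaceEquiv (spaceEquiv.symm f)) = _
  rw [spaceEquiv.apply_symm_apply]

theorem spaceResidue_surjective : Function.Surjective (spaceResidue k) := fun z => by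
  obtain ⟨f, hf⟩ := residueDouble_surjective k.succ_pos z
  exact ⟨spaceEquiv.symm (C f), by rw [spaceResidue_symm, constantCoeff_C, hf]⟩

theorem spaceRestrictAxis_surjective : Function.Surjective spaceRestrictAxis := fun g =>
  ⟨spaceEquiv.symm (map (C.comp C) g), by rw [spaceRestrictAxis_symm, restrictAxis_map]⟩

theorem ker_inf_ker_eq_maximalMinors :
    RingHom.ker (spaceResidue k) ⊓ RingHom.ker spaceRestrictAxis =
      maximalMinors (matrixAVeeL k) := by
  ext f
  obtain ⟨f, rfl⟩ := spaceEquiv.symm.surjective f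
  rw [Ideal.mem_inf, RingHom.mem_ker, RingHom.mem_ker, spaceResidue_symm, spaceRestrictAxis_symm,
    residue_and_restrictAxis_eq_zero_iff, mem_maximalMinors_matrixAVeeL]
  have h : ∀ a b c, a * (MvPowerSeries.X 2 * MvPowerSeries.X 0) +
      b * (MvPowerSeries.X 2 * MvPowerSeries.X 1) +
      c * (MvPowerSeries.X 1 ^ 2 - MvPowerSeries.X 0 ^ (k + 1)) = spaceEquiv.symm
      (spaceEquiv a * (X * C (C X)) + spaceEquiv b * (X * C X) +
        spaceEquiv c * (C X ^ 2 - C (C X) ^ (k + 1))) := fun a b c => by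
    rw [AlgEquiv.eq_symm_apply]
    simp only [map_add, map_mul, map_sub, map_pow, spaceEquiv_X_zero, spaceEquiv_X_one,
      spaceEquiv_X_two]
  constructor
  · rintro ⟨a, b, c, habc⟩
    refine ⟨spaceEquiv.symm a, spaceEquiv.symm b, spaceEquiv.symm c, ?_⟩
    rw [h, spaceEquiv.apply_symm_apply, spaceEquiv.apply_symm_apply, spaceEquiv.apply_symm_apply,
      habc]
  · rintro ⟨a, b, c, habc⟩
    rw [h] at habc
    exact ⟨_, _, _, spaceEquiv.symm.injective habc⟩

theorem isLocalRing_singAVeeL : IsLocalRing (SingAVeeL k) := by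
  have : Nontrivial (SingAVeeL k) := by
    rw [Ideal.Quotient.nontrivial_iff, ← ker_inf_ker_eq_maximalMinors]
    intro h
    have h1 : (1 : MvPowerSeries (Fin 3) ℂ) ∈ RingHom.ker spaceRestrictAxis :=
      (Ideal.mem_inf.1 (h ▸ Submodule.mem_top)).2
    rw [RingHom.mem_ker, map_one] at h1
    exact one_ne_zero h1
  exact IsLocalRing.of_surjective' (Ideal.Quotient.mk _) Ideal.Quotient.mk_surjective

/-- An element (a + bX^(l+1)u, g) with a(0) = g(0) lifts to a + bY + g(Z) - g(0). Agreement at the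
origin is the only condition because the line leaves the plane of the double cover. -/
theorem nonempty_singAVeeL_algEquiv {k m l : ℕ} (hk : k + 1 = 2 * (l + 1) + m) :
    Nonempty (SingAVeeL k ≃ₐ[ℂ] gluedRing m l) := by
  let F : MvPowerSeries (Fin 3) ℂ →ₐ[ℂ] DoubleCoverLine m :=
    ((scaleDouble (l + 1) m hk).comp (spaceResidue k)).prod spaceRestrictAxis
  have hF : ∀ f, F f = (⟨(spaceResidue k f).re, X ^ (l + 1) * (spaceResidue k f).im⟩,
    spaceRestrictAxis f) := fun f => rfl
  refine nonempty_quotient_algEquiv F _ (fun f => ?_) _ ?_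
  · rw [← ker_inf_ker_eq_maximalMinors, Ideal.mem_inf, RingHom.mem_ker, RingHom.mem_ker]
    change (scaleDouble (l + 1) m hk (spaceResidue k f), spaceRestrictAxis f) = 0 ↔ _
    rw [Prod.mk_eq_zero, map_eq_zero_iff _ (scaleDouble_injective _ _ hk)]
  · rintro ⟨⟨a, b⟩, g⟩
    rw [mem_gluedRing]
    constructor
    · rintro ⟨⟨b, rfl⟩, h2⟩
      dsimp only at h2
      refine ⟨spaceEquiv.symm
        (C (C a + C b * X) + map (C.comp C) (g - C (constantCoeff g))), ?_⟩
      have h3 : constantCoeff (map ((C : ℂ⟦X⟧ →+* ℂ⟦X⟧⟦X⟧).comp C)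
          (g - C (constantCoeff g))) = 0 := by
        rw [← coeff_zero_eq_constantCoeff_apply, coeff_map, coeff_zero_eq_constantCoeff_apply,
          map_sub, constantCoeff_C, sub_self, map_zero]
      rw [hF, spaceResidue_symm, spaceRestrictAxis_symm, map_add constantCoeff, constantCoeff_C, h3,
        add_zero, residueDouble_linear, map_add, restrictAxis_C, restrictAxis_map]
      refine Prod.ext rfl ?_
      simp [h2]
    · rintro ⟨f, hf⟩
      obtain ⟨f, rfl⟩ := spaceEquiv.symm.surjective f
      rw [hF, spaceResidue_symm, spaceRestrictAxis_symm] at hf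
      rw [← hf]
      refine ⟨dvd_mul_right _ _, ?_⟩
      dsimp only
      rw [← coeff_zero_restrictLine, ← coeff_zero_eq_constantCoeff_apply, coeff_restrictLine,
        ← coeff_zero_eq_constantCoeff_apply (φ := restrictAxis f), coeff_restrictAxis,
        coeff_zero_eq_constantCoeff_apply, coeff_zero_eq_constantCoeff_apply]

/-- With I = (Z, Y² - X^(k+1)) and J = (X, Y), an f vanishing at the origin splits as f = (f -
f(0,0,Z)) + f(0,0,Z), with summands in J and I. -/
theorem isTransversalUnionALine_of_isTypeAVeeL {B : Type u} [CommRing B] [Algebra ℂ B]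
    (hB : IsTypeAVeeL k B) : IsTransversalUnionALine k B := by
  obtain ⟨e⟩ := hB
  obtain ⟨eA⟩ := nonempty_singA_algEquiv k
  refine ⟨RingHom.ker (spaceResidue k), RingHom.ker spaceRestrictAxis,
    ⟨e.trans (Ideal.quotientEquivAlgOfEq ℂ (ker_inf_ker_eq_maximalMinors k).symm)⟩,
    ⟨(Ideal.quotientKerAlgEquivOfSurjective (spaceResidue_surjective k)).trans eA.symm⟩,
    ⟨Ideal.quotientKerAlgEquivOfSurjective spaceRestrictAxis_surjective⟩, le_antisymm ?_ ?_⟩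
  · refine sup_le (IsLocalRing.le_maximalIdeal ?_) (IsLocalRing.le_maximalIdeal ?_)
    · exact RingHom.ker_ne_top _
    · exact RingHom.ker_ne_top _
  · intro f hf
    obtain ⟨f, rfl⟩ := spaceEquiv.symm.surjective f
    have h0 : constantCoeff (constantCoeff (constantCoeff f)) = 0 := by
      by_contra h0
      have hu : IsUnit f := by
        rw [isUnit_iff_constantCoeff, isUnit_iff_constantCoeff, isUnit_iff_constantCoeff]
        exact isUnit_iff_ne_zero.2 h0
      exact (IsLocalRing.mem_maximalIdeal _).1 hf (hu.map spaceEquiv.symm)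
    rw [← sub_add_cancel f (map (C.comp C) (restrictAxis f)), map_add, sup_comm]
    refine Submodule.add_mem_sup ?_ ?_
    · rw [RingHom.mem_ker, spaceRestrictAxis_symm, map_sub, restrictAxis_map, sub_self]
    · rw [RingHom.mem_ker, spaceResidue_symm]
      have h1 : constantCoeff (restrictAxis f) = 0 := by
        rw [← coeff_zero_eq_constantCoeff_apply, coeff_restrictAxis,
          coeff_zero_eq_constantCoeff_apply, h0]
      rw [← coeff_zero_eq_constantCoeff_apply, coeff_map, coeff_zero_eq_constantCoeff_apply, h1,
        map_zero, map_zero]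

end SpaceCurve

/-! ### The chain of endomorphism rings inside the normalization. -/

section Chain

open PowerSeries

/-- The Jacobson radical of the normalization. -/
noncomputable def normRadical {m : ℕ} (hm : m ≤ 1) : Ideal (DoubleCoverLine m) where
  -- For m = 0, u takes the values ±1 on two branches, so both coefficients must vanish at 0. For m
  -- = 1, u is itself a uniformizer and its coefficient is unrestricted, whence the exponent 1 - m.
  carrier := {x | X ∣ x.1.re ∧ X ^ (1 - m) ∣ x.1.im ∧ X ∣ x.2}
  add_mem' := fun hx hy =>
    ⟨dvd_add hx.1 hy.1, dvd_add hx.2.1 hy.2.1, dvd_add hx.2.2 hy.2.2⟩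
  zero_mem' := ⟨dvd_zero _, dvd_zero _, dvd_zero _⟩
  smul_mem' := by
    rintro c x ⟨h1, h2, h3⟩
    have h4 : X ^ (1 - m) ∣ x.1.re := (pow_dvd_pow X (Nat.sub_le 1 m)).trans (by rwa [pow_one])
    have h5 : (X : ℂ⟦X⟧) ∣ X ^ m * x.1.im := by
      calc (X : ℂ⟦X⟧) = X ^ m * X ^ (1 - m) := by rw [← pow_add, Nat.add_sub_cancel' hm, pow_one]
        _ ∣ _ := mul_dvd_mul_left _ h2
    refine ⟨?_, ?_, dvd_mul_of_dvd_right h3 _⟩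
    · change X ∣ (c.1 * x.1).re
      rw [QuadraticAlgebra.re_mul, mul_right_comm, mul_comm (_ * _) c.1.im]
      exact dvd_add (dvd_mul_of_dvd_right h1 _) (dvd_mul_of_dvd_right h5 _)
    · change X ^ (1 - m) ∣ (c.1 * x.1).im
      rw [QuadraticAlgebra.im_mul, zero_mul, zero_mul, add_zero]
      exact dvd_add (dvd_mul_of_dvd_right h2 _) (dvd_mul_of_dvd_right h4 _)

section

variable {m : ℕ} (hm : m ≤ 1)

theorem normRadical_ne_top : normRadical hm ≠ ⊤ := by
  rw [Ne, Ideal.eq_top_iff_one]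
  rintro ⟨-, -, h⟩
  exact X_prime.not_isUnit (isUnit_of_dvd_one h)

theorem isRadical_normRadical : (normRadical hm).IsRadical := by
  rw [Ideal.isRadical_iff_quotient_reduced, isReduced_iff_pow_one_lt 2 one_lt_two]
  intro x hx
  obtain ⟨⟨⟨a, b⟩, g⟩, rfl⟩ := Ideal.Quotient.mk_surjective x
  rw [← map_pow, Ideal.Quotient.eq_zero_iff_mem, pow_two] at hx
  rw [Ideal.Quotient.eq_zero_iff_mem]
  obtain ⟨h1, h2, h3⟩ := hx
  have hX : Prime (X : ℂ⟦X⟧) := X_prime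
  simp only [Prod.fst_mul, Prod.snd_mul, QuadraticAlgebra.re_mul, QuadraticAlgebra.im_mul, zero_mul,
    add_zero] at h1 h2 h3
  have h4 : X ∣ g := (hX.dvd_or_dvd h3).elim id id
  rcases Nat.le_one_iff_eq_zero_or_eq_one.1 hm with rfl | rfl
  · rw [pow_zero, one_mul] at h1
    have h5 : X ∣ 2 * (a * b) := by
      convert h2 using 1
      · exact (pow_one X).symm
      · ring
    have h6 : ¬ (X : ℂ⟦X⟧) ∣ 2 := by
      rw [X_dvd_iff, map_ofNat]
      exact two_ne_zero
    have h7 : X ∣ a ∧ X ∣ b := by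
      rcases hX.dvd_or_dvd ((hX.dvd_or_dvd h5).resolve_left h6) with ha | hb
      · exact ⟨ha, (hX.dvd_or_dvd ((dvd_add_right (ha.mul_right a)).1 h1)).elim id id⟩
      · exact ⟨(hX.dvd_or_dvd ((dvd_add_left (hb.mul_left b)).1 h1)).elim id id, hb⟩
    exact ⟨h7.1, by simpa using h7.2, h4⟩
  · rw [pow_one, mul_assoc] at h1
    exact ⟨(hX.dvd_or_dvd ((dvd_add_left (dvd_mul_right X _)).1 h1)).elim id id, by simp, h4⟩

theorem isUnit_one_add_of_mem_normRadical (t : DoubleCoverLine m) (ht : t ∈ normRadical hm) :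
    IsUnit (1 + t) := by
  obtain ⟨h1, h2, h3⟩ := ht
  rw [Prod.isUnit_iff, QuadraticAlgebra.isUnit_iff_norm_isUnit, QuadraticAlgebra.norm_def,
    isUnit_iff_constantCoeff, isUnit_iff_constantCoeff]
  rw [X_dvd_iff] at h1 h3
  have h4 : (constantCoeff (X : ℂ⟦X⟧)) ^ m * constantCoeff t.1.im = 0 := by
    rcases Nat.le_one_iff_eq_zero_or_eq_one.1 hm with rfl | rfl
    · rw [pow_zero, one_mul]
      exact X_dvd_iff.1 (by simpa using h2)
    · rw [constantCoeff_X, pow_one, zero_mul]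
  constructor
  · change IsUnit (constantCoeff ((1 + t.1.re) * (1 + t.1.re) + 0 * (1 + t.1.re) * (0 + t.1.im) -
      X ^ m * (0 + t.1.im) * (0 + t.1.im)))
    simp only [map_sub, map_add, map_mul, map_pow, map_one, h1, zero_mul, zero_add, h4,
      add_zero, sub_zero, one_mul, isUnit_one]
  · change IsUnit (constantCoeff (1 + t.2))
    rw [map_add, h3, map_one, add_zero]
    exact isUnit_one

/-- The element `X` of the normalization. -/
noncomputable def uniformizer (m : ℕ) : DoubleCoverLine m :=
  (⟨X, 0⟩, X)

theorem uniformizer_pow_mul (k : ℕ) (x : DoubleCoverLine m) :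
    uniformizer m ^ k * x = (⟨X ^ k * x.1.re, X ^ k * x.1.im⟩, X ^ k * x.2) := by
  induction k with
  | zero =>
    rw [pow_zero, one_mul, pow_zero, one_mul, one_mul, one_mul]
  | succ k ih =>
    rw [pow_succ', mul_assoc, ih]
    refine Prod.ext (QuadraticAlgebra.ext ?_ ?_) ?_
    · change (⟨X, 0⟩ * ⟨X ^ k * x.1.re, X ^ k * x.1.im⟩ : DoubleCover m).re = _
      simp
      ring
    · change (⟨X, 0⟩ * ⟨X ^ k * x.1.re, X ^ k * x.1.im⟩ : DoubleCover m).im = _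
      simp
      ring
    · change X * (X ^ k * x.2) = _
      ring

theorem uniformizer_dvd_iff {x : DoubleCoverLine m} :
    uniformizer m ∣ x ↔ X ∣ x.1.re ∧ X ∣ x.1.im ∧ X ∣ x.2 := by
  have h := uniformizer_pow_mul (m := m) 1
  simp only [pow_one] at h
  constructor
  · rintro ⟨s, rfl⟩
    rw [h]
    exact ⟨dvd_mul_right _ _, dvd_mul_right _ _, dvd_mul_right _ _⟩
  · rintro ⟨⟨a, ha⟩, ⟨b, hb⟩, ⟨g, hg⟩⟩
    refine ⟨(⟨a, b⟩, g), ?_⟩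
    rw [h]
    exact Prod.ext (QuadraticAlgebra.ext ha hb) hg

theorem uniformizer_mem_nonZeroDivisors : uniformizer m ∈ nonZeroDivisors (DoubleCoverLine m) := by
  rw [mem_nonZeroDivisors_iff_right]
  intro x hx
  have h := uniformizer_pow_mul (m := m) 1 x
  simp only [pow_one] at h
  rw [mul_comm, h] at hx
  have h1 := congrArg (fun x : DoubleCoverLine m => x.1.re) hx
  have h2 := congrArg (fun x : DoubleCoverLine m => x.1.im) hx
  have h3 := congrArg (fun x : DoubleCoverLine m => x.2) hx
  exact Prod.ext (QuadraticAlgebra.ext ((mul_eq_zero.1 h1).resolve_left X_ne_zero)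
    ((mul_eq_zero.1 h2).resolve_left X_ne_zero)) ((mul_eq_zero.1 h3).resolve_left X_ne_zero)

theorem uniformizer_mem_normRadical : uniformizer m ∈ normRadical hm :=
  ⟨dvd_rfl, dvd_zero _, dvd_rfl⟩

theorem uniformizer_pow_mul_mem_tangentRing {l k : ℕ} (hk : l + 2 ≤ k) (x : DoubleCoverLine m) :
    uniformizer m ^ k * x ∈ tangentRing m l := by
  rw [uniformizer_pow_mul, mem_tangentRing, mem_gluedRing]
  refine ⟨⟨(pow_dvd_pow X (by omega)).trans (dvd_mul_right _ _), ?_⟩, ?_⟩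
  · simp [zero_pow (show k ≠ 0 by omega)]
  · dsimp only
    rw [coeff_X_pow_mul', coeff_X_pow_mul', if_neg (by omega), if_neg (by omega)]

/-- Squaring is needed for m = 1, where u lies in the radical but is not divisible by X. The
u-coefficient of t² is 2ab, and X ∣ a. -/
theorem uniformizer_dvd_sq_of_mem_normRadical {t : DoubleCoverLine m} (ht : t ∈ normRadical hm) :
    uniformizer m ∣ t ^ 2 := by
  have h1 : t ^ 2 ∈ normRadical hm := Ideal.pow_mem_of_mem _ ht 2 two_pos
  refine uniformizer_dvd_iff.2 ⟨h1.1, ?_, h1.2.2⟩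
  rw [pow_two]
  change X ∣ (t.1 * t.1).im
  rw [QuadraticAlgebra.im_mul, zero_mul, zero_mul, add_zero]
  exact dvd_add (dvd_mul_of_dvd_left ht.1 _) (dvd_mul_of_dvd_right ht.1 _)

theorem exists_pow_mul_mem_tangentRing (l : ℕ) (t : DoubleCoverLine m) (ht : t ∈ normRadical hm) :
    ∃ k, ∀ t', t ^ k * t' ∈ tangentRing m l := by
  obtain ⟨s, hs⟩ := uniformizer_dvd_sq_of_mem_normRadical hm ht
  refine ⟨2 * (l + 2), fun t' => ?_⟩
  rw [pow_mul, hs, mul_pow, mul_assoc]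
  exact uniformizer_pow_mul_mem_tangentRing le_rfl _

theorem mem_normRadical_of_gluedRing {l : ℕ} {x : DoubleCoverLine m} (hx : x ∈ gluedRing m l)
    (h0 : constantCoeff x.1.re = 0) : x ∈ normRadical hm :=
  ⟨X_dvd_iff.2 h0, (pow_dvd_pow X (by omega)).trans hx.1, X_dvd_iff.2 (hx.2 ▸ h0)⟩

/-- Subrings of `gluedRing` have a single residue field ℂ, so a nonzero residue is inverted by a
constant. -/
theorem mem_normRadical_or_exists {l : ℕ} {S : Subalgebra ℂ (DoubleCoverLine m)}
    (hS : S ≤ gluedRing m l) (s : DoubleCoverLine m) (hs : s ∈ S) :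
    s ∈ normRadical hm ∨ ∃ y ∈ S, s * y + 1 ∈ normRadical hm := by
  by_cases h0 : constantCoeff s.1.re = 0
  · exact Or.inl (mem_normRadical_of_gluedRing hm (hS hs) h0)
  · right
    refine ⟨algebraMap ℂ _ (-(constantCoeff s.1.re)⁻¹), S.algebraMap_mem _, ?_⟩
    refine mem_normRadical_of_gluedRing hm
      (hS (S.add_mem (S.mul_mem hs (S.algebraMap_mem _)) S.one_mem)) ?_
    have hC : (algebraMap ℂ (DoubleCoverLine m) (-(constantCoeff s.1.re)⁻¹)).1 =
      ⟨C (-(constantCoeff s.1.re)⁻¹), 0⟩ := rfl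
    rw [Prod.fst_add, Prod.fst_mul, hC, QuadraticAlgebra.re_add, QuadraticAlgebra.re_mul]
    change constantCoeff (_ + 1) = 0
    simp [h0]

theorem gluedRing_le_disjointRing (l : ℕ) : gluedRing m l ≤ disjointRing m (l + 1) :=
  fun _ h => h.1

theorem tangentRing_le_gluedRing (l : ℕ) : tangentRing m l ≤ gluedRing m l :=
  fun _ h => h.1

theorem uniformizer_dvd_of_mem_disjointRing {l : ℕ} {x : DoubleCoverLine m}
    (hx : x ∈ disjointRing m (l + 1)) (hxN : x ∈ normRadical hm) : uniformizer m ∣ x :=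
  uniformizer_dvd_iff.2 ⟨hxN.1, (dvd_pow_self X l.succ_ne_zero).trans hx, hxN.2.2⟩

theorem exists_dvd_tangentRing (l : ℕ) : ∃ v ∈ tangentRing m l, v ∈ normRadical hm ∧
    v ∈ nonZeroDivisors (DoubleCoverLine m) ∧
      ∀ i ∈ tangentRing m l, i ∈ normRadical hm → v ∣ i := by
  -- The element (X, X) is not in A, since its linear terms do not match. Instead v is the class of
  -- X + 2Y, a unit multiple of (X, X). The factor 2 rather than 1 matters for l = m = 0: there X +
  -- Y vanishes on one of the branches Y = ±X.
  let u : DoubleCoverLine m := (⟨1, 2 * X ^ l⟩, 2)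
  have hu : IsUnit u := by
    rw [Prod.isUnit_iff, QuadraticAlgebra.isUnit_iff_norm_isUnit, QuadraticAlgebra.norm_def,
      isUnit_iff_constantCoeff, isUnit_iff_constantCoeff, isUnit_iff_ne_zero, isUnit_iff_ne_zero]
    simp only [u, map_sub, map_add, map_mul, map_pow, map_one, map_zero, constantCoeff_X, map_ofNat]
    constructor
    · by_cases h : m = 0 ∧ l = 0
      · rw [h.1, h.2]
        norm_num
      · have h1 : (0 : ℂ) ^ m * (2 * 0 ^ l) = 0 := by
          rcases not_and_or.1 h with h | h <;> rw [zero_pow h] <;> simp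
        rw [h1]
        norm_num
    · norm_num
  have hv : uniformizer m * u = (⟨X, 2 * X ^ (l + 1)⟩, 2 * X) := by
    have h := uniformizer_pow_mul (m := m) 1 u
    simp only [pow_one] at h
    rw [h]
    refine Prod.ext (QuadraticAlgebra.ext (mul_one _) ?_) (mul_comm _ _)
    change X * (2 * X ^ l) = 2 * X ^ (l + 1)
    ring
  have hmem : uniformizer m * u ∈ tangentRing m l := by
    rw [hv, mem_tangentRing, mem_gluedRing]
    refine ⟨⟨dvd_mul_left _ _, by simp⟩, ?_⟩
    dsimp only
    rw [← map_ofNat (C : ℂ →+* ℂ⟦X⟧), coeff_C_mul, coeff_C_mul, coeff_X_pow_self, coeff_one_X]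
  refine ⟨_, hmem, Ideal.mul_mem_right _ _ (uniformizer_mem_normRadical hm),
    mul_mem uniformizer_mem_nonZeroDivisors hu.mem_nonZeroDivisors, fun i hi hiN => ?_⟩
  rw [hu.mul_right_dvd]
  exact uniformizer_dvd_of_mem_disjointRing hm
    (gluedRing_le_disjointRing l (tangentRing_le_gluedRing l hi)) hiN

theorem exists_dvd_gluedRing (l : ℕ) : ∃ v ∈ gluedRing m l, v ∈ normRadical hm ∧
    v ∈ nonZeroDivisors (DoubleCoverLine m) ∧
      ∀ i ∈ gluedRing m l, i ∈ normRadical hm → v ∣ i :=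
  ⟨uniformizer m, ⟨dvd_zero _, rfl⟩, uniformizer_mem_normRadical hm,
    uniformizer_mem_nonZeroDivisors, fun _ hi hiN =>
      uniformizer_dvd_of_mem_disjointRing hm (gluedRing_le_disjointRing l hi) hiN⟩

theorem exists_dvd_disjointRing (l : ℕ) : ∃ v ∈ disjointRing m l, v ∈ normRadical hm ∧
    v ∈ nonZeroDivisors (DoubleCoverLine m) ∧
      ∀ i ∈ disjointRing m l, i ∈ normRadical hm → v ∣ i := by
  -- In this case the ring is the normalization of a ramified cover, and its radical is generated by
  -- (u, X); the element (X, X) does not divide it. In all other cases (X, X) serves.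
  by_cases h : l = 0 ∧ m = 1
  · obtain ⟨rfl, rfl⟩ := h
    refine ⟨(⟨0, 1⟩, X), ?_, ⟨dvd_zero _, by simp, dvd_rfl⟩, ?_, ?_⟩
    · exact one_dvd _
    · rw [mem_nonZeroDivisors_iff_right]
      rintro ⟨⟨a, b⟩, g⟩ h
      simpa [Prod.ext_iff, QuadraticAlgebra.ext_iff, X_ne_zero, and_comm] using h
    · rintro ⟨⟨a, b⟩, g⟩ - ⟨⟨a, rfl⟩, -, ⟨g, rfl⟩⟩
      refine ⟨(⟨b, a⟩, g), Prod.ext (QuadraticAlgebra.ext ?_ ?_) rfl⟩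
      · change X * a = (⟨0, 1⟩ * ⟨b, a⟩ : DoubleCover 1).re
        simp
      · change b = (⟨0, 1⟩ * ⟨b, a⟩ : DoubleCover 1).im
        simp
  · refine ⟨uniformizer m, dvd_zero _, uniformizer_mem_normRadical hm,
      uniformizer_mem_nonZeroDivisors, fun i hi hiN => ?_⟩
    refine uniformizer_dvd_iff.2 ⟨hiN.1, ?_, hiN.2.2⟩
    rcases Nat.eq_zero_or_pos l with rfl | hl
    · obtain rfl : m = 0 := by omega
      simpa using hiN.2.1
    · exact (dvd_pow_self X hl.ne').trans hi

theorem mem_gluedRing_iff (l : ℕ) (t : DoubleCoverLine m) : t ∈ gluedRing m l ↔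
    ∀ i ∈ tangentRing m l, i ∈ normRadical hm →
      t * i ∈ tangentRing m l ∧ t * i ∈ normRadical hm := by
  constructor
  · rintro ht i hi hiN
    refine ⟨⟨(gluedRing m l).mul_mem ht hi.1, ?_⟩, Ideal.mul_mem_left _ _ hiN⟩
    change coeff (l + 1) (t.1 * i.1).im = coeff 1 (t.2 * i.2)
    rw [QuadraticAlgebra.im_mul, zero_mul, zero_mul, add_zero, map_add,
      coeff_mul_of_X_pow_dvd _ hi.1.1, mul_comm t.1.im, coeff_mul_of_X_pow_dvd _ ht.1,
      coeff_one_mul_of, X_dvd_iff.1 hiN.1, X_dvd_iff.1 hiN.2.2, hi.2, ht.2, zero_mul, mul_zero]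
  · intro h
    -- The test elements are the classes of X and Y. Multiplication by X forces X^(l+1) ∣ b, the
    -- last power coming from the linear condition; multiplication by Y forces a(0) = g(0).
    have h1 := (h (⟨X, 0⟩, 0) ⟨⟨dvd_zero _, by simp⟩, by simp⟩
      ⟨dvd_rfl, dvd_zero _, dvd_zero _⟩).1
    have h2 := (h (⟨0, X ^ (l + 1)⟩, X) ⟨⟨dvd_rfl, by simp⟩, by
      dsimp only
      rw [coeff_X_pow_self, coeff_one_X]⟩
      ⟨dvd_zero _, pow_dvd_pow X (by omega), dvd_rfl⟩).1.2
    have h3 : X ^ (l + 1) ∣ t.1.im := by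
      obtain ⟨⟨h3, -⟩, h4⟩ := h1
      simp only [Prod.fst_mul, Prod.snd_mul, QuadraticAlgebra.im_mul, zero_mul, mul_zero,
        add_zero, zero_add, map_zero] at h3 h4
      rw [pow_succ, mul_dvd_mul_iff_right X_ne_zero] at h3
      rw [coeff_succ_mul_X] at h4
      obtain ⟨b, hb⟩ := h3
      rw [hb, coeff_X_pow_mul', if_pos le_rfl, Nat.sub_self, coeff_zero_eq_constantCoeff] at h4
      rw [hb, pow_succ]
      exact mul_dvd_mul_left _ (X_dvd_iff.2 h4)
    refine ⟨h3, ?_⟩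
    simp only [Prod.fst_mul, Prod.snd_mul, QuadraticAlgebra.im_mul, zero_mul, mul_zero,
        add_zero] at h2
    rw [coeff_mul_of_X_pow_dvd _ dvd_rfl, coeff_X_pow_self, coeff_one_mul_of, coeff_one_X,
      constantCoeff_X, mul_zero, add_zero, mul_one, mul_one] at h2
    exact h2

/-- By `hSN`, S and `disjointRing m l` have the same intersection with N, so the glued and the
disjoint case are treated together. Elements of N have X ∣ a, which gains one power of X, and the
test element (X, 0) shows that no more is gained. At l = 0 truncated subtraction expresses that the
ring is already normal. -/
theorem mem_disjointRing_iff_of_mul {l : ℕ} {S : Subalgebra ℂ (DoubleCoverLine m)}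
    (hS : S ≤ disjointRing m l) (hX : (⟨X, 0⟩, 0) ∈ S)
    (hSN : ∀ x ∈ disjointRing m l, x ∈ normRadical hm → x ∈ S) (t : DoubleCoverLine m) :
    t ∈ disjointRing m (l - 1) ↔
      ∀ i ∈ S, i ∈ normRadical hm → t * i ∈ S ∧ t * i ∈ normRadical hm := by
  constructor
  · intro ht i hi hiN
    have htiN : t * i ∈ normRadical hm := Ideal.mul_mem_left _ _ hiN
    refine ⟨hSN _ ?_ htiN, htiN⟩
    change X ^ l ∣ (t.1 * i.1).im
    rw [QuadraticAlgebra.im_mul, zero_mul, zero_mul, add_zero]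
    refine dvd_add (dvd_mul_of_dvd_right (hS hi) _) ?_
    refine (pow_dvd_pow X (by omega : l ≤ (l - 1) + 1)).trans ?_
    rw [pow_succ]
    exact mul_dvd_mul ht hiN.1
  · intro h
    have h1 := hS (h _ hX ⟨dvd_rfl, dvd_zero _, dvd_zero _⟩).1
    rw [mem_disjointRing] at h1 ⊢
    simp only [Prod.fst_mul, QuadraticAlgebra.im_mul, zero_mul, mul_zero, add_zero, zero_add] at h1
    cases l with
    | zero => exact one_dvd _
    | succ l => rwa [pow_succ, mul_dvd_mul_iff_right X_ne_zero] at h1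

theorem mem_disjointRing_iff_gluedRing (l : ℕ) (t : DoubleCoverLine m) :
    t ∈ disjointRing m l ↔ ∀ i ∈ gluedRing m l, i ∈ normRadical hm →
      t * i ∈ gluedRing m l ∧ t * i ∈ normRadical hm :=
  mem_disjointRing_iff_of_mul hm (gluedRing_le_disjointRing l) ⟨dvd_zero _, by simp⟩
    (fun x hx hxN => ⟨hx, by rw [X_dvd_iff.1 hxN.1, X_dvd_iff.1 hxN.2.2]⟩) t

theorem mem_disjointRing_pred_iff (l : ℕ) (t : DoubleCoverLine m) :
    t ∈ disjointRing m (l - 1) ↔ ∀ i ∈ disjointRing m l, i ∈ normRadical hm →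
      t * i ∈ disjointRing m l ∧ t * i ∈ normRadical hm :=
  mem_disjointRing_iff_of_mul hm le_rfl (dvd_zero _) (fun _ hx _ => hx) t

end

/-- The chain of rings of the normalization algorithm. -/
noncomputable def ringChain (m l : ℕ) : ℕ → Subalgebra ℂ (DoubleCoverLine m)
  | 0 => tangentRing m l
  | 1 => gluedRing m l
  | i + 2 => disjointRing m (l - i)

/-- Each inclusion is strict because of one element: (X^(l+1)u, 0) violates the tangency, the
idempotent (1, 0) violates the gluing, and afterwards a lower power of X times u becomes available.
-/
theorem ringChain_ne (m l : ℕ) {i : ℕ} (hi : i < l + 2) :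
    ringChain m l i ≠ ringChain m l (i + 1) := by
  intro h
  match i with
  | 0 =>
    have h1 : ((⟨0, X ^ (l + 1)⟩, 0) : DoubleCoverLine m) ∈ gluedRing m l := ⟨dvd_rfl, rfl⟩
    have h2 := (h.symm.le h1 : _ ∈ tangentRing m l).2
    dsimp only at h2
    rw [coeff_X_pow_self, map_zero] at h2
    exact one_ne_zero h2
  | 1 =>
    have h1 : ((⟨1, 0⟩, 0) : DoubleCoverLine m) ∈ disjointRing m l := dvd_zero _
    have h2 := (h.symm.le h1 : _ ∈ gluedRing m l).2
    simp at h2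
  | i + 2 =>
    have h1 : ((⟨0, X ^ (l - (i + 1))⟩, 0) : DoubleCoverLine m) ∈ disjointRing m (l - (i + 1)) :=
      dvd_rfl
    have h2 : X ^ (l - i) ∣ (X : ℂ⟦X⟧) ^ (l - (i + 1)) := h.symm.le h1
    rw [pow_dvd_pow_iff X_ne_zero X_prime.not_isUnit] at h2
    omega

theorem ringChain_stable (m l : ℕ) : ringChain m l (l + 2) = ringChain m l (l + 3) := by
  change disjointRing m (l - l) = disjointRing m (l - (l + 1))
  congr 1
  omega

theorem tangentRing_le_ringChain (m l i : ℕ) : tangentRing m l ≤ ringChain m l i := by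
  match i with
  | 0 => exact le_rfl
  | 1 => exact tangentRing_le_gluedRing l
  | i + 2 =>
    intro x hx
    exact (pow_dvd_pow X (by omega)).trans (hx.1.1)

theorem exists_dvd_ringChain {m : ℕ} (hm : m ≤ 1) (l i : ℕ) : ∃ v ∈ ringChain m l i,
    v ∈ normRadical hm ∧ v ∈ nonZeroDivisors (DoubleCoverLine m) ∧
      ∀ j ∈ ringChain m l i, j ∈ normRadical hm → v ∣ j :=
  match i with
  | 0 => exists_dvd_tangentRing hm l
  | 1 => exists_dvd_gluedRing hm l
  | i + 2 => exists_dvd_disjointRing hm (l - i)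

theorem mem_ringChain_succ_iff {m : ℕ} (hm : m ≤ 1) (l i : ℕ) (t : DoubleCoverLine m) :
    t ∈ ringChain m l (i + 1) ↔ ∀ j ∈ ringChain m l i, j ∈ normRadical hm →
      t * j ∈ ringChain m l i ∧ t * j ∈ normRadical hm :=
  match i with
  | 0 => mem_gluedRing_iff hm l t
  | 1 => mem_disjointRing_iff_gluedRing hm l t
  | i + 2 => mem_disjointRing_pred_iff hm (l - i) t

end Chain

/-! ### Regularity of the normalization. -/

section Regular

/-- Projection onto a factor is localization at the idempotent e, so R at the pulled-back prime has
the same local ring as S at p. -/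
theorem isRegularLocalRing_localization_comap {R S : Type*} [CommRing R] [CommRing S]
    [IsRegularRing S] (f : R →+* S) (hf : Function.Surjective f) {e : R} (he : IsIdempotentElem e)
    (hker : ∀ x y, f x = f y ↔ e * x = e * y) (q : Ideal R) (p : Ideal S) [p.IsPrime] [q.IsPrime]
    (hq : q = p.comap f) : IsRegularLocalRing (Localization.AtPrime q) := by
  subst hq
  let := f.toAlgebra
  have : IsLocalization.Away e S := IsLocalization.away_of_isIdempotentElem_of_mul he hker hf
  have hloc : IsLocalization.AtPrime (Localization.AtPrime p) (p.comap f) :=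
    IsLocalization.isLocalization_isLocalization_atPrime_isLocalization (Submonoid.powers e)
      (Localization.AtPrime p) p
  exact IsRegularLocalRing.of_ringEquiv
    (IsLocalization.algEquiv (p.comap f).primeCompl (Localization.AtPrime p)
      (Localization.AtPrime (p.comap f))).toRingEquiv

theorem isRegularRing_prod (R S : Type*) [CommRing R] [CommRing S] [IsRegularRing R]
    [IsRegularRing S] : IsRegularRing (R × S) := by
  rw [isRegularRing_iff]
  intro q hq
  rcases (Ideal.ideal_prod_prime q).1 hq with ⟨p, hp, h⟩ | ⟨p, hp, h⟩
  · refine isRegularLocalRing_localization_comap (RingHom.fst R S) Prod.fst_surjective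
      (e := (1, 0)) (by ext <;> simp) (fun x y => by simp [Prod.ext_iff]) q p ?_
    rw [h]
    ext x
    simp [Ideal.mem_prod]
  · refine isRegularLocalRing_localization_comap (RingHom.snd R S) Prod.snd_surjective
      (e := (0, 1)) (by ext <;> simp) (fun x y => by simp [Prod.ext_iff]) q p ?_
    rw [h]
    ext x
    simp [Ideal.mem_prod]

open PowerSeries

theorem nonempty_doubleCover_zero_ringEquiv : Nonempty (DoubleCover 0 ≃+* ℂ⟦X⟧ × ℂ⟦X⟧) := by
  have h2 : (C (1 / 2 : ℂ) : ℂ⟦X⟧) * 2 = 1 := by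
    rw [← map_ofNat (C : ℂ →+* ℂ⟦X⟧), ← map_mul]
    norm_num
  exact ⟨{
    toFun := fun z => (z.re + z.im, z.re - z.im)
    invFun := fun w => ⟨C (1 / 2) * (w.1 + w.2), C (1 / 2) * (w.1 - w.2)⟩
    left_inv := fun z => QuadraticAlgebra.ext
      (by dsimp only; linear_combination z.re * h2) (by dsimp only; linear_combination z.im * h2)
    right_inv := fun w => Prod.ext
      (by dsimp only; linear_combination w.1 * h2) (by dsimp only; linear_combination w.2 * h2)
    map_mul' := fun z w => Prod.ext
      (by simp only [QuadraticAlgebra.re_mul, QuadraticAlgebra.im_mul, Prod.fst_mul]; ring)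
      (by simp only [QuadraticAlgebra.re_mul, QuadraticAlgebra.im_mul, Prod.snd_mul]; ring)
    map_add' := fun z w => Prod.ext
      (by simp only [QuadraticAlgebra.re_add, QuadraticAlgebra.im_add, Prod.fst_add]; ring)
      (by simp only [QuadraticAlgebra.re_add, QuadraticAlgebra.im_add, Prod.snd_add]; ring) }⟩

theorem isUnit_doubleCover_one_iff (z : DoubleCover 1) : IsUnit z ↔ constantCoeff z.re ≠ 0 := by
  rw [QuadraticAlgebra.isUnit_iff_norm_isUnit, QuadraticAlgebra.norm_def, isUnit_iff_constantCoeff,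
    isUnit_iff_ne_zero]
  simp

theorem isLocalRing_doubleCover_one : IsLocalRing (DoubleCover 1) := by
  refine IsLocalRing.of_nonunits_add fun a b ha hb => ?_
  rw [mem_nonunits_iff, isUnit_doubleCover_one_iff, not_not] at ha hb ⊢
  rw [QuadraticAlgebra.re_add, map_add, ha, hb, add_zero]

/-- The norm a² - Xb² vanishes only at 0, since a² has even order and Xb² odd order. -/
theorem isDomain_doubleCover_one : IsDomain (DoubleCover 1) := by
  have hnorm : ∀ z : DoubleCover 1, QuadraticAlgebra.norm z = 0 → z = 0 := by
    intro z hz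
    replace hz : z.re * z.re = X * z.im * z.im := by
      rw [QuadraticAlgebra.norm_def] at hz
      linear_combination hz
    by_cases hi : z.im = 0
    · rw [hi, mul_zero, mul_self_eq_zero] at hz
      exact QuadraticAlgebra.ext hz hi
    · have hr : z.re ≠ 0 := by
        intro hr
        rw [hr, mul_zero, eq_comm, mul_assoc, mul_eq_zero, mul_self_eq_zero] at hz
        exact hz.elim X_ne_zero hi
      have h := congrArg order hz
      rw [order_mul, order_mul, order_mul, order_X, ← coe_toNat_order hi,
        ← coe_toNat_order hr] at h
      norm_cast at h
      omega
  have : NoZeroDivisors (DoubleCover 1) := ⟨fun {a b} hab => by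
    have h := congrArg QuadraticAlgebra.norm hab
    rw [map_mul, QuadraticAlgebra.norm_zero, mul_eq_zero] at h
    exact h.imp (hnorm a) (hnorm b)⟩
  exact NoZeroDivisors.to_isDomain _

/-- The maximal ideal is generated by ω, so this Noetherian local domain is a Dedekind domain. -/
theorem isRegularRing_doubleCover_one : IsRegularRing (DoubleCover 1) := by
  have := isLocalRing_doubleCover_one
  have := isDomain_doubleCover_one
  have : IsNoetherianRing (DoubleCover 1) := IsNoetherianRing.of_finite ℂ⟦X⟧ _
  have hmax : (IsLocalRing.maximalIdeal (DoubleCover 1)).IsPrincipal := by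
    refine ⟨QuadraticAlgebra.omega, ?_⟩
    ext z
    rw [IsLocalRing.mem_maximalIdeal, mem_nonunits_iff, isUnit_doubleCover_one_iff, not_not,
      ← X_dvd_iff]
    change _ ↔ z ∈ Ideal.span _
    rw [Ideal.mem_span_singleton]
    constructor
    · rintro ⟨a, ha⟩
      refine ⟨⟨z.im, a⟩, QuadraticAlgebra.ext ?_ ?_⟩ <;> simp [ha]
    · rintro ⟨w, rfl⟩
      simp
  have hded : IsDedekindDomain (DoubleCover 1) :=
    ((tfae_of_isNoetherianRing_of_isLocalRing_of_isDomain (DoubleCover 1)).out 4 2).1 hmax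
  infer_instance

theorem isRegularRing_doubleCoverLine {m : ℕ} (hm : m ≤ 1) : IsRegularRing (DoubleCoverLine m) := by
  have : IsRegularRing (DoubleCover m) := by
    rcases Nat.le_one_iff_eq_zero_or_eq_one.1 hm with rfl | rfl
    · obtain ⟨e⟩ := nonempty_doubleCover_zero_ringEquiv
      have := isRegularRing_prod ℂ⟦X⟧ ℂ⟦X⟧
      exact IsRegularRing.of_ringEquiv e.symm
    · exact isRegularRing_doubleCover_one
  exact isRegularRing_prod _ _

end Regular

/-! ### The Gorenstein obstruction for A' and the main theorem. -/

section Main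

open PowerSeries

theorem doubleCoverLine_ext {m : ℕ} {x y : DoubleCoverLine m} (h1 : x.1.re = y.1.re)
    (h2 : x.1.im = y.1.im) (h3 : x.2 = y.2) : x = y :=
  Prod.ext (QuadraticAlgebra.ext h1 h2) h3

theorem not_hasInjectiveDimensionLE_of_gluedRing {R : Type u} [CommRing R] {m l : ℕ}
    (e : R ≃+* gluedRing m l) (d : ℕ) :
    ¬ CategoryTheory.HasInjectiveDimensionLE (ModuleCat.of R R) d := by
  let f : R →+* DoubleCoverLine m := (gluedRing m l).toSubring.subtype.comp
    (e : R →+* gluedRing m l)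
  have hf : Function.Injective f := Subtype.val_injective.comp e.injective
  have hmem : ∀ r, f r ∈ gluedRing m l := fun r => (e r).2
  have hsurj : ∀ t ∈ gluedRing m l, ∃ r, f r = t := fun t ht =>
    ⟨e.symm ⟨t, ht⟩, congrArg Subtype.val (e.apply_symm_apply ⟨t, ht⟩)⟩
  obtain ⟨x, hx⟩ := hsurj (⟨X, 0⟩, 0) ⟨dvd_zero _, by simp⟩
  obtain ⟨y, hy⟩ := hsurj (⟨0, X ^ (l + 1)⟩, 0) ⟨dvd_rfl, by simp⟩
  obtain ⟨z, hz⟩ := hsurj (0, X) ⟨dvd_zero _, by simp⟩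
  -- Here y' = y²/x, the image of y under multiplication by y/x = X^l u, an element of A'' outside
  -- A'.
  obtain ⟨y', hy'⟩ := hsurj (⟨X ^ (2 * l + 1 + m), 0⟩, 0)
    ⟨dvd_zero _, by simp [zero_pow (show 2 * l + 1 + m ≠ 0 by omega)]⟩
  have hrel : ∀ a b : R, a * x + b * y = 0 →
      (f a).1.re * X + X ^ m * (f b).1.im * X ^ (l + 1) = 0 ∧
        (f a).1.im * X + (f b).1.re * X ^ (l + 1) = 0 := by
    intro a b hab
    have h := congrArg f hab
    rw [map_add, map_mul, map_mul, hx, hy, map_zero] at h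
    have h1 := congrArg (fun t : DoubleCoverLine m => t.1.re) h
    have h2 := congrArg (fun t : DoubleCoverLine m => t.1.im) h
    simpa using And.intro h1 h2
  refine not_hasInjectiveDimensionLE (x := x) (y := y) (z := z) (y' := y') ?_ ?_ ?_ ?_ ?_ d
  · intro r
    have hrz : r * z = 0 ↔ (f r).2 = 0 := by
      rw [← map_eq_zero_iff f hf, map_mul, hz]
      simp [Prod.ext_iff, X_ne_zero]
    rw [hrz]
    constructor
    · intro h
      obtain ⟨⟨b, hb⟩, h0⟩ := hmem r
      rw [h, map_zero] at h0
      obtain ⟨a, ha⟩ := X_dvd_iff.2 h0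
      obtain ⟨a', ha'⟩ := hsurj (⟨a, 0⟩, C (constantCoeff a)) ⟨dvd_zero _, by simp⟩
      obtain ⟨b', hb'⟩ := hsurj (⟨b, 0⟩, C (constantCoeff b)) ⟨dvd_zero _, by simp⟩
      refine ⟨a', b', hf ?_⟩
      rw [map_add, map_mul, map_mul, ha', hb', hx, hy]
      refine doubleCoverLine_ext ?_ ?_ ?_
      · simp [ha, mul_comm]
      · simp [hb, mul_comm]
      · simp [h]
    · rintro ⟨a, b, rfl⟩
      rw [map_add, map_mul, map_mul, hx, hy]
      simp
  · intro r hr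
    rw [← map_eq_zero_iff f hf, map_mul, map_mul, hz] at hr
    rw [← map_eq_zero_iff f hf, map_mul, hz]
    simpa [Prod.ext_iff, X_ne_zero] using hr
  · intro a b hab
    have h1 := (hrel a b hab).1
    have h2 : X ∣ (f a).1.re := by
      obtain ⟨w, hw⟩ := (hmem b).1
      rw [hw] at h1
      exact ⟨-(X ^ (m + 2 * l) * w), mul_right_cancel₀ X_ne_zero (by linear_combination h1)⟩
    -- By gluing, a vanishes at the origin of the line as well, so it agrees there with a multiple
    -- of z.
    have h3 : constantCoeff (f a).2 = 0 := by rw [← (hmem a).2, X_dvd_iff.1 h2]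
    obtain ⟨g, hg⟩ := X_dvd_iff.2 h3
    obtain ⟨c, hc⟩ := hsurj (⟨C (constantCoeff g), 0⟩, g) ⟨dvd_zero _, by simp⟩
    refine ⟨c, hf ?_⟩
    rw [map_mul, map_sub, map_mul, hc, hz, map_zero]
    refine doubleCoverLine_ext ?_ ?_ ?_
    · simp
    · simp
    · simp [hg, mul_comm]
  · intro a b hab
    obtain ⟨h1, h2⟩ := hrel a b hab
    apply hf
    rw [map_add, map_mul, map_mul, hy, hy', map_zero]
    refine doubleCoverLine_ext ?_ ?_ ?_
    · simp
      linear_combination X ^ (m + l) * h2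
    · simp
      linear_combination X ^ l * h1
    · simp
  · intro r hr
    have h := congrArg (fun t => (f t).1.im) hr
    rw [map_mul, hx, hy] at h
    simp only [Prod.fst_mul, QuadraticAlgebra.im_mul, mul_zero, zero_mul, zero_add, add_zero] at h
    obtain ⟨b, hb⟩ := (hmem r).1
    rw [hb, mul_right_comm, ← pow_succ] at h
    have h1 : (X : ℂ⟦X⟧) ^ (l + 2) ∣ X ^ (l + 1) := ⟨b, h⟩
    rw [pow_dvd_pow_iff X_ne_zero X_prime.not_isUnit] at h1
    omega

theorem endRing_eq_of_eq {A : Type u} [CommRing A] {B B' : Subalgebra A (FractionRing A)}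
    (h : B = B') (J : ∀ B : Subalgebra A (FractionRing A), Ideal B) :
    endRing B (J B) = endRing B' (J B') := by
  rw [h]

/-- The rings of the normalization algorithm of a singularity of type `D`. -/
theorem exists_normStep_model {A : Type u} [CommRing A] [Algebra ℂ A] {m l : ℕ} (hm : m ≤ 1)
    (e : A ≃ₐ[ℂ] tangentRing m l) : ∃ B : ℕ → Subalgebra A (FractionRing A),
      (∀ i, Nonempty (B i ≃ₐ[ℂ] ringChain m l i)) ∧
      (∀ i, normStep (Ring.jacobson A) i = B i) ∧ (∀ i < 2, primeRing (B i) = B (i + 1)) ∧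
      ∀ i j, B i = B j ↔ ringChain m l i = ringChain m l j := by
  let φ : A →ₐ[ℂ] DoubleCoverLine m := (tangentRing m l).val.comp (e : A →ₐ[ℂ] tangentRing m l)
  let := φ.toRingHom.toAlgebra
  have : IsScalarTower ℂ A (DoubleCoverLine m) :=
    IsScalarTower.of_algebraMap_eq fun c => (φ.commutes c).symm
  have hinj : Function.Injective (algebraMap A (DoubleCoverLine m)) :=
    Subtype.val_injective.comp e.injective
  have hsurj : ∀ t ∈ tangentRing m l, ∃ a, algebraMap A (DoubleCoverLine m) a = t := fun t ht =>
    ⟨e.symm ⟨t, ht⟩, congrArg Subtype.val (e.apply_symm_apply ⟨t, ht⟩)⟩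
  obtain ⟨c, hc⟩ := hsurj (uniformizer m ^ (l + 2) * 1)
    (uniformizer_pow_mul_mem_tangentRing le_rfl 1)
  rw [mul_one] at hc
  obtain ⟨ι, hι, hunit⟩ := exists_algHom_fractionRing hinj c
    (hc ▸ pow_mem uniformizer_mem_nonZeroDivisors _)
    fun t => hsurj _ (hc ▸ uniformizer_pow_mul_mem_tangentRing le_rfl t)
  -- The same rings, regarded as algebras over A instead of ℂ.
  let S : ℕ → Subalgebra A (DoubleCoverLine m) := fun i =>
    { (ringChain m l i).toSubring with
      algebraMap_mem' := fun a => tangentRing_le_ringChain m l i (e a).2 }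
  have hS : ∀ i t, t ∈ S i ↔ t ∈ ringChain m l i := fun _ _ => Iff.rfl
  have hpow : ∀ t ∈ normRadical hm, ∃ k : ℕ, ∀ t', ∃ a,
      algebraMap A (DoubleCoverLine m) a = t ^ k * t' := by
    intro t ht
    obtain ⟨k, hk⟩ := exists_pow_mul_mem_tangentRing hm l t ht
    exact ⟨k, fun t' => hsurj _ (hk t')⟩
  have hjac : ∀ a : A, a ∈ Ring.jacobson A ↔
      algebraMap A (DoubleCoverLine m) a ∈ normRadical hm := by
    refine mem_jacobson_iff_map_mem hinj (normRadical_ne_top hm)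
      (isUnit_one_add_of_mem_normRadical hm) hpow fun a => ?_
    refine (mem_normRadical_or_exists hm (tangentRing_le_gluedRing l) _ (e a).2).imp id ?_
    rintro ⟨y, hy, hay⟩
    obtain ⟨b, rfl⟩ := hsurj y hy
    exact ⟨b, by rwa [map_add, map_mul, map_one]⟩
  have hend : ∀ i (J : Ideal ((S i).map ι)),
      (∀ x, x ∈ J ↔ ∃ j ∈ S i, j ∈ normRadical hm ∧ ι j = x) →
        endRing ((S i).map ι) J = (S (i + 1)).map ι := by
    intro i J hJ
    obtain ⟨v, hvS, hvN, hv, hdvd⟩ := exists_dvd_ringChain hm l i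
    exact endRing_map_eq hJ hvS hvN (hunit v hv) hι hdvd (mem_ringChain_succ_iff hm l i)
  have hbot : (S 0).map ι = ⊥ := by
    rw [← Algebra.map_bot ι]
    congr 1
    ext t
    rw [Algebra.mem_bot, hS]
    exact ⟨fun h => hsurj t h, fun ⟨a, ha⟩ => ha ▸ (e a).2⟩
  refine ⟨fun i => (S i).map ι, fun i => ?_, fun i => ?_, fun i hi => ?_, fun i j => ?_⟩
  · let e₁ : ringChain m l i ≃ₐ[ℂ] S i :=
      { toFun := fun x => ⟨x, x.2⟩
        invFun := fun x => ⟨x, x.2⟩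
        left_inv := fun _ => rfl
        right_inv := fun _ => rfl
        map_mul' := fun _ _ => rfl
        map_add' := fun _ _ => rfl
        commutes' := fun c => rfl }
    exact ⟨(e₁.trans (((S i).equivMapOfInjective ι hι).restrictScalars ℂ)).symm⟩
  · induction i with
    | zero => exact hbot.symm
    | succ i ih =>
      change _ = (S (i + 1)).map ι
      rw [← hend i _ (mem_radical_map_jacobson_iff (isRadical_normRadical hm) hjac hpow hι (S i))]
      exact endRing_eq_of_eq ih fun B => ((Ring.jacobson A).map (algebraMap A B)).radical
  -- Only the first two rings are local in the sense required here; they suffice for A' and A''.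
  · refine hend i _ (mem_jacobson_map_iff (normRadical_ne_top hm)
      (isUnit_one_add_of_mem_normRadical hm) hpow hι ?_)
    interval_cases i
    · exact mem_normRadical_or_exists hm (tangentRing_le_gluedRing l)
    · exact mem_normRadical_or_exists hm le_rfl
  · refine (Subalgebra.map_injective hι).eq_iff.trans ⟨fun h => ?_, fun h => ?_⟩
    · ext t
      rw [← hS, ← hS, h]
    · ext t
      rw [hS, hS, h]

theorem mainTheorem7 {A : Type u} [CommRing A] [Algebra ℂ A] (n : ℕ) (hn : 4 ≤ n)
    (hA : IsTypeD n A) :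
    let A' : Subalgebra A (FractionRing A) := primeRing ⊥
    let A'' : Subalgebra A (FractionRing A) := primeRing A'
    IsTypeAVeeL (n - 3) A' ∧
    IsTransversalUnionALine (n - 3) A' ∧
    (IsLocalRing A' ∧ IsNoetherianRing A' ∧ ¬ IsGorensteinLocalRing A') ∧
    (6 ≤ n → Nonempty (A'' ≃ₐ[ℂ] SingA (n - 5) × PowerSeries ℂ)) ∧
    ((n = 4 ∨ n = 5) → IsRegularRing A'') ∧
    numNormSteps A = n / 2 := by
  intro A' A''
  -- The parity m of n decides whether Y² = X^(n-2) has two branches or one, and l + 2 is the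
  -- expected number of steps.
  obtain ⟨m, l, hm, rfl⟩ : ∃ m l, m ≤ 1 ∧ n = 2 * (l + 1) + m + 2 :=
    ⟨n % 2, n / 2 - 2, by omega, by omega⟩
  obtain ⟨eA⟩ := hA
  obtain ⟨eD⟩ := nonempty_singD_algEquiv m l
  obtain ⟨B, hB, hstep, hprime, hinj⟩ := exists_normStep_model hm (eA.trans eD)
  have hA' : A' = B 1 := by
    rw [← hprime 0 two_pos, ← hstep 0]
    rfl
  have hA'' : A'' = B 2 := by
    rw [← hprime 1 one_lt_two, ← hA']
  obtain ⟨e₁⟩ := hB 1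
  obtain ⟨e₂⟩ := hB 2
  rw [← hA'] at e₁
  rw [← hA''] at e₂
  clear_value A' A''
  change A' ≃ₐ[ℂ] gluedRing m l at e₁
  change A'' ≃ₐ[ℂ] disjointRing m l at e₂
  obtain ⟨eV⟩ := nonempty_singAVeeL_algEquiv
    (show 2 * (l + 1) + m + 2 - 3 + 1 = 2 * (l + 1) + m by omega)
  have hV : IsTypeAVeeL (2 * (l + 1) + m + 2 - 3) A' := ⟨e₁.trans eV.symm⟩
  have eR : SingAVeeL (2 * (l + 1) + m + 2 - 3) ≃+* A' := (eV.trans e₁.symm).toRingEquiv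
  have hlocal := isLocalRing_singAVeeL (2 * (l + 1) + m + 2 - 3)
  refine ⟨hV, isTransversalUnionALine_of_isTypeAVeeL _ hV, ⟨eR.isLocalRing,
    isNoetherianRing_of_ringEquiv _ eR, ?_⟩, fun h6 => ?_, fun h => ?_, ?_⟩
  · rintro ⟨-, -, d, hd⟩
    exact not_hasInjectiveDimensionLE_of_gluedRing e₁.toRingEquiv d hd
  · obtain ⟨e₃⟩ := nonempty_disjointRing_algEquiv m l
    have hsing : ∀ k j, k + 1 = j → Nonempty (SingA k ≃ₐ[ℂ] DoubleCover j) := by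
      rintro k _ rfl
      exact nonempty_singA_algEquiv k
    obtain ⟨e₄⟩ := hsing (2 * (l + 1) + m + 2 - 5) (2 * l + m) (by omega)
    exact ⟨(e₂.trans e₃).trans (AlgEquiv.prodCongr e₄.symm AlgEquiv.refl)⟩
  -- For n = 4 and n = 5 the second step already reaches the whole normalization.
  · obtain rfl : l = 0 := by omega
    have htop : disjointRing m 0 = ⊤ := by
      rw [eq_top_iff]
      exact fun x _ => one_dvd _
    have := isRegularRing_doubleCoverLine hm
    rw [htop] at e₂
    exact IsRegularRing.of_ringEquiv (e₂.trans Subalgebra.topEquiv).symm.toRingEquiv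
  · have hset : ∀ i, normStep (Ring.jacobson A) i = normStep (Ring.jacobson A) (i + 1) ↔
        ringChain m l i = ringChain m l (i + 1) := fun i => by
      rw [hstep, hstep, hinj]
    rw [numNormSteps, numSteps, show (2 * (l + 1) + m + 2) / 2 = l + 2 by omega]
    refine IsLeast.csInf_eq ⟨(hset _).2 (ringChain_stable m l), fun i hi => ?_⟩
    by_contra hlt
    exact ringChain_ne m l (not_le.1 hlt) ((hset i).1 hi)

end Main
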